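/- Let $k\ge 2$ and write points of $\mathbb{R}^k=\mathbb{R}^{k-1}\times\mathbb{R}$ as $(x',y)$. Let $v:\mathbb{R}^{k-1}\to[0,\infty)$ be Lebesgue measurable and put $$F[v]=\Big\{(x',y)\in\mathbb{R}^k:\ |y|<\tfrac12 v(x')\Big\}.$$ For a Lebesgue measurable set $E\subset\mathbb{R}^k$ and an open set $O\subset\mathbb{R}^k$ let $$P(E;O)=\sup\Big\{\int_E \operatorname{div}T\,dx:\ T\in C^1_c(O;\mathbb{R}^k),\ |T|\le 1\Big\};$$ $E$ has locally finite perimeter if $P(E;V)<\infty$ for every open set $V$ with compact closure in $\mathbb{R}^k$. In that case the distributional derivative $D\chi_E$ of the characteristic function of $E$ is an $\mathbb{R}^k$-valued Radon measure, with total variation $|D\chi_E|$. The reduced boundary $\partial^*E$ is the set of points $p\in\mathbb{R}^k$ at which the limit $$\nu^E(p)=\lim_{\rho\to0^+}\frac{D\chi_E(B_\rho(p))}{|D\chi_E|(B_\rho(p))}$$ exists and is a unit vector; $\nu^E=(\nu^E_1,\dots,\nu^E_k)$ is the inner unit normal. For $A\subset\mathbb{R}^k$ and $x'\in\mathbb{R}^{k-1}$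 let $A_{x'}=\{y\in\mathbb{R}:(x',y)\in A\}$. **Proposition.** Suppose that $F[v]$ has locally finite perimeter. Then, for every $x'\in\mathbb{R}^{k-1}$ such that $(\partial^*F[v])_{x'}\neq\emptyset$, the functions $$y\mapsto \nu^{F[v]}_i(x',y)\quad (i=1,\dots,k-1),\qquad y\mapsto |\nu^{F[v]}_k(x',y)|$$ are constant on $(\partial^*F[v])_{x'}$. -/

import Mathlib

open MeasureTheory Filter Topology
open scoped ENNReal

noncomputable section

namespace Steiner

/-- The classical divergence of a vector field on `ℝ^k`. -/
def divergence {k : ℕ} (T : EuclideanSpace ℝ (Fin k) → EuclideanSpace ℝ (Fin k))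
    (x : EuclideanSpace ℝ (Fin k)) : ℝ :=
  ∑ i : Fin k, (fderiv ℝ T x (EuclideanSpace.single i 1)) i

/-- The admissible test fields: `T ∈ C¹_c(O; ℝ^k)` with `|T| ≤ 1`. -/
def testFields {k : ℕ} (O : Set (EuclideanSpace ℝ (Fin k))) :
    Set (EuclideanSpace ℝ (Fin k) → EuclideanSpace ℝ (Fin k)) :=
  {T | ContDiff ℝ 1 T ∧ HasCompactSupport T ∧ tsupport T ⊆ O ∧ ∀ x, ‖T x‖ ≤ 1}

/-- The relative perimeter `P(E; O) ∈ [0, ∞]` of `E` in the open set `O`, as the supremum of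
`∫_E div T` over the test fields. (The field `T = 0` is admissible, so truncating negative
integrals at `0` does not change the supremum.) -/
def perimeter {k : ℕ} (E O : Set (EuclideanSpace ℝ (Fin k))) : ℝ≥0∞ :=
  ⨆ T ∈ testFields O, ENNReal.ofReal (∫ x in E, divergence T x)

/-- `E` is a (Lebesgue measurable) set of locally finite perimeter in `ℝ^k`:
`P(E; V) < ∞` for every open `V` compactly contained in `ℝ^k`. -/
def IsLocallyFinitePerimeter {k : ℕ} (E : Set (EuclideanSpace ℝ (Fin k))) : Prop :=
  NullMeasurableSet E volume ∧
    ∀ V : Set (EuclideanSpace ℝ (Fin k)), IsOpen V → IsCompact (closure V) → perimeter E V < ⊤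

/-- `(μ, σ)` is the polar decomposition of the distributional derivative `Dχ_E`: `μ` is a Radon
measure, `|σ| = 1` holds `μ`-a.e., and `Dχ_E = σ μ` as distributions. Such a pair is unique
(`σ` up to `μ`-null sets), `μ = |Dχ_E|`, and it exists iff `E` has locally finite perimeter. -/
structure IsPolarDerivative {k : ℕ} (E : Set (EuclideanSpace ℝ (Fin k)))
    (μ : Measure (EuclideanSpace ℝ (Fin k)))
    (σ : EuclideanSpace ℝ (Fin k) → EuclideanSpace ℝ (Fin k)) : Prop where
  locallyFinite : IsLocallyFiniteMeasure μ
  measurable : Measurable σ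
  norm_eq_one : ∀ᵐ x ∂μ, ‖σ x‖ = 1
  integral_divergence : ∀ T : EuclideanSpace ℝ (Fin k) → EuclideanSpace ℝ (Fin k),
    ContDiff ℝ 1 T → HasCompactSupport T →
      ∫ x in E, divergence T x = -∫ x, inner ℝ (T x) (σ x) ∂μ

open Classical in
/-- The polar decomposition `(|Dχ_E|, σ)` of `Dχ_E` (and `(0, 0)` if `Dχ_E` is not a measure,
that is, if `E` is not of locally finite perimeter). -/
def polarDerivative {k : ℕ} (E : Set (EuclideanSpace ℝ (Fin k))) :
    Measure (EuclideanSpace ℝ (Fin k)) ×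
      (EuclideanSpace ℝ (Fin k) → EuclideanSpace ℝ (Fin k)) :=
  if h : ∃ p : Measure (EuclideanSpace ℝ (Fin k)) ×
      (EuclideanSpace ℝ (Fin k) → EuclideanSpace ℝ (Fin k)), IsPolarDerivative E p.1 p.2
  then h.choose else (0, 0)

/-- The total variation measure `|Dχ_E|`. -/
def totalVariation {k : ℕ} (E : Set (EuclideanSpace ℝ (Fin k))) :
    Measure (EuclideanSpace ℝ (Fin k)) :=
  (polarDerivative E).1

/-- The vector `Dχ_E(A) ∈ ℝ^k`, for `A` a bounded Borel set. -/
def derivMeasure {k : ℕ} (E A : Set (EuclideanSpace ℝ (Fin k))) : EuclideanSpace ℝ (Fin k) :=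
  ∫ y in A, (polarDerivative E).2 y ∂(totalVariation E)

/-- The quotient `Dχ_E(B_ρ(x)) / |Dχ_E|(B_ρ(x))`. It is `0` if the denominator vanishes. -/
def normalQuotient {k : ℕ} (E : Set (EuclideanSpace ℝ (Fin k))) (x : EuclideanSpace ℝ (Fin k))
    (ρ : ℝ) : EuclideanSpace ℝ (Fin k) :=
  ((totalVariation E).real (Metric.ball x ρ))⁻¹ • derivMeasure E (Metric.ball x ρ)

/-- The reduced boundary `∂*E`: the points where the limit as `ρ → 0⁺` of
`Dχ_E(B_ρ(x)) / |Dχ_E|(B_ρ(x))` exists and is a unit vector. -/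
def reducedBoundary {k : ℕ} (E : Set (EuclideanSpace ℝ (Fin k))) :
    Set (EuclideanSpace ℝ (Fin k)) :=
  {x | ∃ ν : EuclideanSpace ℝ (Fin k), ‖ν‖ = 1 ∧ Tendsto (normalQuotient E x) (𝓝[>] 0) (𝓝 ν)}

/-- The measure-theoretic inner unit normal `ν^E` (meaningful on `∂*E`). -/
def innerNormal {k : ℕ} (E : Set (EuclideanSpace ℝ (Fin k))) (x : EuclideanSpace ℝ (Fin k)) :
    EuclideanSpace ℝ (Fin k) :=
  limUnder (𝓝[>] (0 : ℝ)) (normalQuotient E x)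

/-- The defining property of `ν^E` on `∂*E`. -/
theorem innerNormal_spec {k : ℕ} {E : Set (EuclideanSpace ℝ (Fin k))}
    {x : EuclideanSpace ℝ (Fin k)} (hx : x ∈ reducedBoundary E) :
    ‖innerNormal E x‖ = 1 ∧ Tendsto (normalQuotient E x) (𝓝[>] 0) (𝓝 (innerNormal E x)) := by
  obtain ⟨ν, hν, h⟩ := hx
  have : innerNormal E x = ν := h.limUnder_eq
  rw [this]
  exact ⟨hν, h⟩

/-- The point `(x', y)` of `ℝ^{n+1} = ℝ^n × ℝ`. -/
def point {n : ℕ} (x' : EuclideanSpace ℝ (Fin n)) (y : ℝ) : EuclideanSpace ℝ (Fin (n + 1)) :=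
  WithLp.toLp 2 (Fin.snoc (α := fun _ => ℝ) (fun i => x' i) y)

/-- The component `x' ∈ ℝ^n` of a point `p = (x', y)` of `ℝ^{n+1} = ℝ^n × ℝ`. -/
def base {n : ℕ} (p : EuclideanSpace ℝ (Fin (n + 1))) : EuclideanSpace ℝ (Fin n) :=
  WithLp.toLp 2 (fun i : Fin n => p i.castSucc)

/-- The component `y ∈ ℝ` of a point `p = (x', y)` of `ℝ^{n+1} = ℝ^n × ℝ`. -/
def height {n : ℕ} (p : EuclideanSpace ℝ (Fin (n + 1))) : ℝ :=
  p (Fin.last n)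

/-- The slice `A_{x'} = {y : (x', y) ∈ A}`. -/
def slice {n : ℕ} (A : Set (EuclideanSpace ℝ (Fin (n + 1)))) (x' : EuclideanSpace ℝ (Fin n)) :
    Set ℝ :=
  {y | point x' y ∈ A}

/-- The Steiner symmetric set `F[v] = {(x', y) : |y| < v(x') / 2}`. -/
def symmetral {n : ℕ} (v : EuclideanSpace ℝ (Fin n) → ℝ) :
    Set (EuclideanSpace ℝ (Fin (n + 1))) :=
  {p | |height p| < 1 / 2 * v (base p)}

end Steiner

end

/-!
The proof rests on De Giorgi's blow-up principle: at a point `p` of the reduced boundary of a set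
`F`, the rescaled sets `(F - p) / ρ` converge to the half-space `{e | ⟪e, ν⟫ > 0}`, where
`ν = innerNormal F p`. Granting this, let `p₁ = (x', y₁)` and `p₂ = (x', y₂)` both lie in the
reduced boundary of a symmetral. If `|y₁| < |y₂|`, then `|y₁ + s| ≤ |y₂ + s|` for small `s`, and so
`p₂ + z ∈ F` implies `p₁ + z ∈ F` for small `z`. The two blow-up half-spaces are therefore nested,
which forces the normals to agree. If `y₁ = -y₂`, the vertical reflection takes the role of the
identity and the normals are mirror images of each other. Both cases are instances of
`innerNormal_eq_of_eventually_mem`.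

Only a quantitative form of the blow-up principle is needed, and it is proved without compactness
theorems: for `⟪e, ν⟫ > 0` a small ball `B(p + ρ e, t ρ)` lies in `F` up to a set of volume
`o(ρ ^ k)`, `k` being the dimension (`IsPolarDerivative.eventually_volume_sdiff_le`). Its main tool is the estimate
`IsPolarDerivative.volume_shift_le`: the translation by `h` moves out of `F` at most the mass
`∫ max (-⟪h, σ⟫) 0 d|Dχ_F|`. Near `p` the density `σ` is on average close to `ν`, so for `h` in a
cone around `ν` this mass is `o(ρ ^ k)`; here one needs the bound `|Dχ_F|(B_ρ) = O(ρ ^ (k - 1))`,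
which follows by testing with radial cutoffs (`IsPolarDerivative.exists_measureReal_ball_le`).
Integrating over all translations from `F ∩ B(p, t ρ)` to `B(p + ρ e, t ρ) \ F`
(`mul_volume_le_of_translate`) shows that the product of the volumes of these two sets is
`o(ρ ^ (2 k))`, and the first volume is at least `c ρ ^ k` by the density estimate
`IsPolarDerivative.exists_volume_ball_ge`. The density estimate is an iteration based on a local
isoperimetric inequality (`IsPolarDerivative.volume_inter_ball_le`), which is again a consequence of
the translation estimate. The complementary half-space is treated by passing to `Fᶜ`, whose
derivative is `-Dχ_F`.
-/

namespace Steiner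

/-! ### Polar decompositions of `Dχ_E` -/

section Polar

variable {k : ℕ} {E : Set (EuclideanSpace ℝ (Fin k))} {μ : Measure (EuclideanSpace ℝ (Fin k))}
  {σ : EuclideanSpace ℝ (Fin k) → EuclideanSpace ℝ (Fin k)}

theorem divergence_smul_const {g : EuclideanSpace ℝ (Fin k) → ℝ} {x : EuclideanSpace ℝ (Fin k)}
    (hg : DifferentiableAt ℝ g x) (w : EuclideanSpace ℝ (Fin k)) :
    divergence (fun x => g x • w) x = fderiv ℝ g x w := by
  have hw : w = ∑ i, w i • EuclideanSpace.single i (1 : ℝ) := by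
    ext j
    simp [Pi.single_apply]
  conv_rhs => rw [hw, map_sum]
  simp only [divergence, fderiv_smul_const hg w, map_smul, smul_eq_mul]
  refine Finset.sum_congr rfl fun i _ => ?_
  simp [mul_comm]

theorem integrable_mul_inner_of_hasCompactSupport (hP : IsPolarDerivative E μ σ)
    {g : EuclideanSpace ℝ (Fin k) → ℝ} (hg : Continuous g) (hc : HasCompactSupport g)
    (w : EuclideanSpace ℝ (Fin k)) : Integrable (fun x => g x * inner ℝ w (σ x)) μ := by
  have := hP.locallyFinite
  refine (hg.integrable_of_hasCompactSupport hc (μ := μ)).mul_bdd (c := ‖w‖) ?_ ?_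
  · exact (measurable_const.inner hP.measurable).aestronglyMeasurable
  · filter_upwards [hP.norm_eq_one] with x hx
    simpa [hx] using norm_inner_le_norm (𝕜 := ℝ) w (σ x)

/-- The directional form of the Gauss–Green formula defining `Dχ_E`. -/
theorem IsPolarDerivative.setIntegral_fderiv (hP : IsPolarDerivative E μ σ)
    {g : EuclideanSpace ℝ (Fin k) → ℝ} (hg : ContDiff ℝ 1 g) (hc : HasCompactSupport g)
    (w : EuclideanSpace ℝ (Fin k)) :
    ∫ x in E, fderiv ℝ g x w = -∫ x, g x * inner ℝ w (σ x) ∂μ := by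
  have h := hP.integral_divergence (fun x => g x • w) (hg.smul contDiff_const) hc.smul_right
  simp only [real_inner_smul_left] at h
  rw [← h]
  congr 1
  ext x
  rw [divergence_smul_const (hg.differentiable one_ne_zero x)]

theorem hasCompactSupport_fderiv_apply {g : EuclideanSpace ℝ (Fin k) → ℝ}
    (hc : HasCompactSupport g) (w : EuclideanSpace ℝ (Fin k)) :
    HasCompactSupport fun x => fderiv ℝ g x w := by
  refine (hc.fderiv (𝕜 := ℝ)).comp_left (g := fun L : EuclideanSpace ℝ (Fin k) →L[ℝ] ℝ => L w) ?_
  simp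

theorem integral_divergence_eq_zero {T : EuclideanSpace ℝ (Fin k) → EuclideanSpace ℝ (Fin k)}
    (hT : ContDiff ℝ 1 T) (hc : HasCompactSupport T) : ∫ x, divergence T x = 0 := by
  have hcont : ∀ i : Fin k, Continuous fun x => (fderiv ℝ T x (EuclideanSpace.single i 1)) i :=
    fun i => by
      have := hT.continuous_fderiv one_ne_zero
      fun_prop
  have hsupp : ∀ i : Fin k,
      HasCompactSupport fun x => (fderiv ℝ T x (EuclideanSpace.single i 1)) i := fun i =>
    (hc.fderiv (𝕜 := ℝ)).comp_left
      (g := fun L : EuclideanSpace ℝ (Fin k) →L[ℝ] EuclideanSpace ℝ (Fin k) =>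
        (L (EuclideanSpace.single i 1)) i) (by simp)
  unfold divergence
  rw [integral_finsetSum _ fun i _ => (hcont i).integrable_of_hasCompactSupport (hsupp i)]
  refine Finset.sum_eq_zero fun i _ => ?_
  have hTi : ContDiff ℝ 1 fun x => T x i := by fun_prop
  have hci : HasCompactSupport fun x => T x i :=
    hc.comp_left (g := fun z : EuclideanSpace ℝ (Fin k) => z i) (by simp)
  have hd : ∀ x, (fderiv ℝ T x (EuclideanSpace.single i 1)) i
      = fderiv ℝ (fun x => T x i) x (EuclideanSpace.single i 1) := fun x => by
    have h1 := (hT.differentiable one_ne_zero x).hasFDerivAt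
    have h2 := (EuclideanSpace.proj (𝕜 := ℝ) i :
      EuclideanSpace ℝ (Fin k) →L[ℝ] ℝ).hasFDerivAt.comp x h1
    have h3 : HasFDerivAt (fun x => T x i) _ x := h2
    rw [h3.fderiv]
    simp
  simp_rw [hd]
  -- Integration by parts against the constant function `1`.
  have := integral_mul_fderiv_eq_neg_fderiv_mul_of_integrable (μ := volume)
    (f := fun _ : EuclideanSpace ℝ (Fin k) => (1 : ℝ)) (g := fun x => T x i)
    (v := EuclideanSpace.single i 1)
    (by simp) (by
      simpa using ((hTi.continuous_fderiv one_ne_zero).clm_apply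
        continuous_const).integrable_of_hasCompactSupport
        (hasCompactSupport_fderiv_apply hci _))
    (by simpa using hTi.continuous.integrable_of_hasCompactSupport hci)
    (fun _ _ => differentiableAt_const _)
    (fun x _ => hTi.differentiable one_ne_zero x)
  simpa using this

/-- The complement has the opposite derivative: `Dχ_{Eᶜ} = -Dχ_E`. -/
theorem IsPolarDerivative.compl (hE : MeasurableSet E) (hP : IsPolarDerivative E μ σ) :
    IsPolarDerivative Eᶜ μ fun x => -σ x where
  locallyFinite := hP.locallyFinite
  measurable := hP.measurable.neg
  norm_eq_one := by simpa using hP.norm_eq_one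
  integral_divergence T hT hc := by
    have hcont : Continuous (divergence T) := by
      have := hT.continuous_fderiv one_ne_zero
      unfold divergence
      fun_prop
    have hsupp : HasCompactSupport (divergence T) :=
      (hc.fderiv (𝕜 := ℝ)).comp_left
        (g := fun L : EuclideanSpace ℝ (Fin k) →L[ℝ] EuclideanSpace ℝ (Fin k) =>
          ∑ i, (L (EuclideanSpace.single i 1)) i) (by simp)
    have h := integral_add_compl hE (hcont.integrable_of_hasCompactSupport hsupp (μ := volume))
    rw [integral_divergence_eq_zero hT hc, hP.integral_divergence T hT hc] at h
    simp only [inner_neg_right, integral_neg]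
    linarith

theorem IsPolarDerivative.congr_set {E' : Set (EuclideanSpace ℝ (Fin k))}
    (hP : IsPolarDerivative E μ σ) (h : E =ᵐ[volume] E') : IsPolarDerivative E' μ σ where
  locallyFinite := hP.locallyFinite
  measurable := hP.measurable
  norm_eq_one := hP.norm_eq_one
  integral_divergence T hT hc := by
    rw [← setIntegral_congr_set h]
    exact hP.integral_divergence T hT hc

theorem IsPolarDerivative.integrableOn_ball (hP : IsPolarDerivative E μ σ)
    (p : EuclideanSpace ℝ (Fin k)) (r : ℝ) : IntegrableOn σ (Metric.ball p r) μ := by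
  have := hP.locallyFinite
  refine Measure.integrableOn_of_bounded (M := 1) measure_ball_lt_top.ne
    hP.measurable.aestronglyMeasurable ?_
  filter_upwards [ae_restrict_of_ae hP.norm_eq_one] with x hx using hx.le

end Polar

/-! ### Translations and the total variation -/

section Shift

variable {k : ℕ} {E : Set (EuclideanSpace ℝ (Fin k))} {μ : Measure (EuclideanSpace ℝ (Fin k))}
  {σ : EuclideanSpace ℝ (Fin k) → EuclideanSpace ℝ (Fin k)}

theorem IsPolarDerivative.integrableOn_inner (hP : IsPolarDerivative E μ σ)
    (p w : EuclideanSpace ℝ (Fin k)) (r : ℝ) :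
    IntegrableOn (fun x => inner ℝ w (σ x)) (Metric.ball p r) μ :=
  (hP.integrableOn_ball p r).const_inner w

theorem IsPolarDerivative.integrableOn_negPart (hP : IsPolarDerivative E μ σ)
    (p w : EuclideanSpace ℝ (Fin k)) (r : ℝ) :
    IntegrableOn (fun x => max (-inner ℝ w (σ x)) 0) (Metric.ball p r) μ :=
  (hP.integrableOn_inner p w r).neg.pos_part

theorem hasDerivAt_setIntegral_translate {φ : EuclideanSpace ℝ (Fin k) → ℝ}
    (hφ : ContDiff ℝ 1 φ) (hc : HasCompactSupport φ) (h : EuclideanSpace ℝ (Fin k)) (t₀ : ℝ) :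
    HasDerivAt (fun t : ℝ => ∫ x in E, φ (x - t • h))
      (∫ x in E, fderiv ℝ φ (x - t₀ • h) (-h)) t₀ := by
  obtain ⟨R, hR⟩ : ∃ R, tsupport φ ⊆ Metric.closedBall 0 R :=
    hc.isCompact.isBounded.subset_closedBall 0
  obtain ⟨C, hC⟩ := (hφ.continuous_fderiv one_ne_zero).bounded_above_of_compact_support
    (hc.fderiv (𝕜 := ℝ))
  have hcont : ∀ t : ℝ, Continuous fun x => φ (x - t • h) := fun t => by
    have := hφ.continuous
    fun_prop
  have hsupp : ∀ t : ℝ, HasCompactSupport fun x => φ (x - t • h) := fun t => by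
    simpa [Function.comp_def, sub_eq_add_neg] using
      hc.comp_homeomorph (Homeomorph.addRight (-(t • h)))
  have hcont' : Continuous fun x => fderiv ℝ φ (x - t₀ • h) (-h) := by
    have := hφ.continuous_fderiv one_ne_zero
    fun_prop
  set B := Metric.closedBall (0 : EuclideanSpace ℝ (Fin k)) (R + (|t₀| + 1) * ‖h‖) with hB
  refine (hasDerivAt_integral_of_dominated_loc_of_deriv_le
    (bound := B.indicator fun _ => C * ‖h‖)
    (F := fun (t : ℝ) x => φ (x - t • h)) (F' := fun t x => fderiv ℝ φ (x - t • h) (-h))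
    (Metric.ball_mem_nhds t₀ one_pos)
    (Eventually.of_forall fun t => (hcont t).aestronglyMeasurable)
    ((hcont t₀).integrable_of_hasCompactSupport (hsupp t₀)).integrableOn
    hcont'.aestronglyMeasurable ?_ ?_ ?_).2
  · refine Eventually.of_forall fun x t ht => ?_
    by_cases hx : x - t • h ∈ tsupport φ
    · have hxB : x ∈ B := by
        have h1 := hR hx
        rw [mem_closedBall_zero_iff] at h1
        rw [hB, mem_closedBall_zero_iff]
        have h2 : |t| ≤ |t₀| + 1 := by
          rw [Metric.mem_ball, Real.dist_eq] at ht
          have := abs_sub_abs_le_abs_sub t t₀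
          linarith
        calc ‖x‖ = ‖(x - t • h) + t • h‖ := by simp
          _ ≤ ‖x - t • h‖ + ‖t • h‖ := norm_add_le _ _
          _ ≤ R + (|t₀| + 1) * ‖h‖ := by
            rw [norm_smul, Real.norm_eq_abs]
            gcongr
      rw [Set.indicator_of_mem hxB]
      calc ‖fderiv ℝ φ (x - t • h) (-h)‖ ≤ ‖fderiv ℝ φ (x - t • h)‖ * ‖-h‖ :=
            ContinuousLinearMap.le_opNorm _ _
        _ ≤ C * ‖h‖ := by
            rw [norm_neg]
            gcongr
            exact hC _
    · have : fderiv ℝ φ (x - t • h) = 0 := by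
        by_contra hne
        exact hx (support_fderiv_subset ℝ hne)
      have hC0 : 0 ≤ C := (norm_nonneg _).trans (hC 0)
      simp only [this, zero_apply, norm_zero]
      exact Set.indicator_nonneg (fun _ _ => by positivity) _
  · exact ((integrable_indicator_iff measurableSet_closedBall).2
      (integrableOn_const (Metric.isBounded_closedBall.measure_lt_top.ne))).integrableOn
  · refine Eventually.of_forall fun x t _ => ?_
    have h1 : HasDerivAt (fun t : ℝ => x - t • h) (-h) t := by
      simpa using ((hasDerivAt_id t).smul_const h).const_sub x
    exact (hφ.differentiable one_ne_zero _).hasFDerivAt.comp_hasDerivAt t h1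

/-- A weighted form of `volume_shift_le`, proved by differentiating
`t ↦ ∫_E φ (x - t h) dx` along the segment `[0, 1]`. -/
theorem IsPolarDerivative.setIntegral_sub_translate_le (hP : IsPolarDerivative E μ σ)
    {φ : EuclideanSpace ℝ (Fin k) → ℝ} (hφ : ContDiff ℝ 1 φ) (hc : HasCompactSupport φ)
    (h0 : ∀ x, 0 ≤ φ x) (h1 : ∀ x, φ x ≤ 1) {p : EuclideanSpace ℝ (Fin k)} {r : ℝ}
    (hr : ∀ x, x ∉ Metric.ball p r → φ x = 0) (h : EuclideanSpace ℝ (Fin k)) :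
    (∫ x in E, φ x) - ∫ x in E, φ (x - h) ≤
      ∫ x in Metric.ball p (r + ‖h‖), max (-inner ℝ h (σ x)) 0 ∂μ := by
  set D := ∫ x in Metric.ball p (r + ‖h‖), max (-inner ℝ h (σ x)) 0 ∂μ with hD
  have hder := hasDerivAt_setIntegral_translate (E := E) hφ hc h
  have hge : ∀ t ∈ interior (Set.Icc (0 : ℝ) 1),
      -D ≤ deriv (fun t : ℝ => ∫ x in E, φ (x - t • h)) t := by
    intro t ht
    rw [interior_Icc] at ht
    have hgt : ContDiff ℝ 1 fun x => φ (x - t • h) := by fun_prop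
    have hgc : HasCompactSupport fun x => φ (x - t • h) := by
      simpa [Function.comp_def, sub_eq_add_neg] using
        hc.comp_homeomorph (Homeomorph.addRight (-(t • h)))
    have hfd : ∀ x, fderiv ℝ φ (x - t • h) (-h) = fderiv ℝ (fun x => φ (x - t • h)) x (-h) :=
      fun x => by rw [fderiv_comp_sub]
    rw [(hder t).deriv]
    simp_rw [hfd]
    rw [hP.setIntegral_fderiv hgt hgc, neg_le_neg_iff, hD,
      ← integral_indicator Metric.isOpen_ball.measurableSet]
    refine integral_mono (integrable_mul_inner_of_hasCompactSupport hP hgt.continuous hgc _)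
      ((integrable_indicator_iff Metric.isOpen_ball.measurableSet).2
        (hP.integrableOn_negPart p h _)) fun x => ?_
    by_cases hx : x ∈ Metric.ball p (r + ‖h‖)
    · simp only [Set.indicator_of_mem hx, inner_neg_left]
      have a0 := h0 (x - t • h)
      have a1 := h1 (x - t • h)
      have b0 := le_max_left (-inner ℝ h (σ x)) 0
      have b1 := le_max_right (-inner ℝ h (σ x)) 0
      calc φ (x - t • h) * -inner ℝ h (σ x) ≤ φ (x - t • h) * max (-inner ℝ h (σ x)) 0 := by
            gcongr
        _ ≤ 1 * max (-inner ℝ h (σ x)) 0 := by gcongr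
        _ = _ := one_mul _
    · have : φ (x - t • h) = 0 := by
        refine hr _ fun hmem => hx ?_
        rw [mem_ball_iff_norm] at hmem ⊢
        calc ‖x - p‖ = ‖(x - t • h - p) + t • h‖ := by congr 1; abel
          _ ≤ ‖x - t • h - p‖ + ‖t • h‖ := norm_add_le _ _
          _ < r + ‖h‖ := by
            rw [norm_smul, Real.norm_eq_abs, abs_of_pos ht.1]
            have : t * ‖h‖ ≤ 1 * ‖h‖ := by gcongr; exact ht.2.le
            linarith
      simp [Set.indicator_of_notMem hx, this]
  have hmv := (convex_Icc (0 : ℝ) 1).mul_sub_le_image_sub_of_le_deriv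
    (fun t _ => (hder t).continuousAt.continuousWithinAt)
    (fun t _ => (hder t).differentiableAt.differentiableWithinAt) hge
    0 (by simp) 1 (by simp) zero_le_one
  simp only [zero_smul, one_smul, sub_zero, mul_one] at hmv
  linarith

/-- A translation by `h` moves out of `E` at most as much mass as the part of `Dχ_E` that
decreases in the direction `h`. -/
theorem IsPolarDerivative.volume_shift_le (hP : IsPolarDerivative E μ σ) (hE : MeasurableSet E)
    (p : EuclideanSpace ℝ (Fin k)) (r : ℝ) (h : EuclideanSpace ℝ (Fin k)) :
    volume.real {x | (x ∈ Metric.ball p r ∧ x ∈ E) ∧ x + h ∉ E} ≤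
      ∫ x in Metric.ball p (r + ‖h‖), max (-inner ℝ h (σ x)) 0 ∂μ := by
  set S := {x | (x ∈ Metric.ball p r ∧ x ∈ E) ∧ x + h ∉ E} with hS
  set Eh := {x | x + h ∈ E} with hEh
  have hEhm : MeasurableSet Eh := (measurable_add_const h) hE
  have hSm : MeasurableSet S := (Metric.isOpen_ball.measurableSet.inter hE).inter hEhm.compl
  have hSfin : volume S ≠ ⊤ :=
    ((measure_mono fun x hx => hx.1.1).trans_lt
      (measure_ball_lt_top (x := p) (r := r) (μ := volume))).ne
  refine le_of_forall_pos_le_add fun ε hε => ?_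
  have hε' : ENNReal.ofReal (ε / 3) ≠ 0 := by simpa using hε
  -- The indicator of `S` is approximated by a smooth function that is `1` on `K` and `0` off `U`.
  obtain ⟨K, hKS, hK, hSK⟩ := hSm.exists_isCompact_sdiff_lt hSfin hε'
  obtain ⟨O, hSO, hO, -, hOS⟩ := hSm.exists_isOpen_sdiff_lt hSfin hε'
  set U := O ∩ Metric.ball p r with hU
  have hUo : IsOpen U := hO.inter Metric.isOpen_ball
  have hSU : S ⊆ U := fun x hx => ⟨hSO hx, hx.1.1⟩
  have hUfin : volume U ≠ ⊤ :=
    ((measure_mono Set.inter_subset_right).trans_lt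
      (measure_ball_lt_top (x := p) (r := r) (μ := volume))).ne
  obtain ⟨f, hf0, hf1, hf⟩ := exists_contMDiffMap_zero_one_of_isClosed (n := 1)
    (modelWithCornersSelf ℝ (EuclideanSpace ℝ (Fin k))) hUo.isClosed_compl hK.isClosed
    (Set.disjoint_left.2 fun x hx hxK => hx (hSU (hKS hxK)))
  have hfd : ContDiff ℝ 1 f := f.contMDiff.contDiff
  have hfU : ∀ x, x ∉ U → f x = 0 := fun x hx => hf0 hx
  have hfc : HasCompactSupport f := by
    refine HasCompactSupport.intro (isCompact_closedBall p r) fun x hx => hfU x fun hxU => ?_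
    exact hx (Metric.ball_subset_closedBall hxU.2)
  have hmain := hP.setIntegral_sub_translate_le hfd hfc (fun x => (hf x).1) (fun x => (hf x).2)
    (p := p) (r := r) (fun x hx => hfU x fun hxU => hx hxU.2) h
  have hfi : Integrable f volume := hfd.continuous.integrable_of_hasCompactSupport hfc
  have htr : ∫ x in E, f (x - h) = ∫ x in Eh, f x := by
    rw [← integral_indicator hE, ← integral_indicator hEhm,
      ← integral_add_right_eq_self (E.indicator fun x => f (x - h)) h]
    congr 1
    ext x
    by_cases hx : x + h ∈ E
    · rw [Set.indicator_of_mem hx, Set.indicator_of_mem (show x ∈ Eh from hx)]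
      simp
    · rw [Set.indicator_of_notMem hx, Set.indicator_of_notMem (show x ∉ Eh from hx)]
  have hUK : volume.real (U \ K) ≤ 2 * (ε / 3) := by
    have h1 : volume.real (U \ K) ≤ volume.real (O \ S) + volume.real (S \ K) := by
      refine (measureReal_mono ?_ ?_).trans (measureReal_union_le _ _)
      · rintro x ⟨hxU, hxK⟩
        by_cases hxS : x ∈ S
        · exact Or.inr ⟨hxS, hxK⟩
        · exact Or.inl ⟨hxU.1, hxS⟩
      · exact (measure_union_lt_top (hOS.trans ENNReal.ofReal_lt_top)
          (hSK.trans ENNReal.ofReal_lt_top)).ne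
    have h2 : volume.real (O \ S) ≤ ε / 3 := ENNReal.toReal_le_of_le_ofReal (by positivity) hOS.le
    have h3 : volume.real (S \ K) ≤ ε / 3 := ENNReal.toReal_le_of_le_ofReal (by positivity) hSK.le
    linarith
  have hSK' : volume.real S ≤ volume.real K + ε / 3 := by
    have h3 : volume.real (S \ K) ≤ ε / 3 := ENNReal.toReal_le_of_le_ofReal (by positivity) hSK.le
    rw [measureReal_sdiff hKS hK.measurableSet hSfin] at h3
    linarith
  have hlow : volume.real K - volume.real (U \ K) ≤ (∫ x in E, f x) - ∫ x in Eh, f x := by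
    have hKm := hK.measurableSet
    have hUKm := hUo.measurableSet.diff hKm
    have i1 : Integrable (K.indicator fun _ => (1 : ℝ)) volume :=
      (integrable_indicator_iff hKm).2 (integrableOn_const hK.measure_lt_top.ne)
    have i2 : Integrable ((U \ K).indicator fun _ => (1 : ℝ)) volume :=
      (integrable_indicator_iff hUKm).2
        (integrableOn_const ((measure_mono Set.sdiff_subset).trans_lt hUfin.lt_top).ne)
    rw [← integral_indicator hE, ← integral_indicator hEhm, ← integral_sub
      (hfi.indicator hE) (hfi.indicator hEhm), ← integral_indicator_one hKm,
      ← integral_indicator_one hUKm]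
    refine (integral_sub i1 i2).symm.trans_le (integral_mono (i1.sub i2)
      ((hfi.indicator hE).sub (hfi.indicator hEhm)) fun x => ?_)
    have a0 := (hf x).1
    have a1 := (hf x).2
    by_cases hxK : x ∈ K
    · have hxS := hKS hxK
      have : f x = 1 := hf1 hxK
      have hx1 : x ∈ E := hxS.1.2
      have hx2 : x ∉ Eh := hxS.2
      simp [hxK, hx1, hx2, this]
    · by_cases hxU : x ∈ U
      · by_cases hx1 : x ∈ E <;> by_cases hx2 : x ∈ Eh <;>
          simp [hxK, hxU, hx1, hx2] <;> linarith
      · simp [hxK, hxU, Set.indicator, hfU x hxU]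
  rw [htr] at hmain
  linarith

end Shift

/-! ### Radial cutoffs and an upper bound for the total variation -/

section Radial

theorem exists_bound_deriv_smoothTransition :
    ∃ K : ℝ, 0 < K ∧ ∀ x, |deriv Real.smoothTransition x| ≤ K := by
  have hcont : Continuous (deriv Real.smoothTransition) :=
    (Real.smoothTransition.contDiff (n := 1)).continuous_deriv (le_refl _)
  obtain ⟨C, hC⟩ := (isCompact_Icc (a := (0 : ℝ)) (b := 1)).exists_bound_of_continuousOn
    hcont.continuousOn
  refine ⟨max C 1, by positivity, fun x => ?_⟩
  by_cases hx : x ∈ Set.Icc (0 : ℝ) 1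
  · exact (hC x hx).trans (le_max_left _ _)
  · have h0 : deriv Real.smoothTransition x = 0 := by
      rcases lt_or_ge x 0 with h | h
      · refine IsLocalMin.deriv_eq_zero (Eventually.of_forall fun y => ?_)
        rw [Real.smoothTransition.zero_of_nonpos h.le]
        exact Real.smoothTransition.nonneg y
      · have h1 : 1 ≤ x := by
          by_contra hlt
          exact hx ⟨h, (not_le.1 hlt).le⟩
        refine IsLocalMax.deriv_eq_zero (Eventually.of_forall fun y => ?_)
        rw [Real.smoothTransition.one_of_one_le h1]
        exact Real.smoothTransition.le_one y
    simp [h0]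

variable {k : ℕ}

/-- A smooth radial cutoff, equal to `1` on the ball of radius `r` and supported in the ball of
radius `R`, whose superlevel sets are balls. -/
noncomputable def radialCutoff (p : EuclideanSpace ℝ (Fin k)) (r R : ℝ)
    (x : EuclideanSpace ℝ (Fin k)) : ℝ :=
  Real.smoothTransition ((R ^ 2 - ‖x - p‖ ^ 2) / (R ^ 2 - r ^ 2))

variable {p : EuclideanSpace ℝ (Fin k)} {r R : ℝ}

theorem radialCutoff_nonneg (x : EuclideanSpace ℝ (Fin k)) : 0 ≤ radialCutoff p r R x :=
  Real.smoothTransition.nonneg _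

theorem contDiff_radialCutoff : ContDiff ℝ 1 (radialCutoff p r R) := by
  unfold radialCutoff
  refine Real.smoothTransition.contDiff.comp ?_
  refine (contDiff_const.sub ?_).div_const _
  exact (contDiff_id.sub contDiff_const).norm_sq ℝ

theorem radialCutoff_eq_zero (hr : 0 < r) (hR : r < R) {x : EuclideanSpace ℝ (Fin k)}
    (hx : x ∉ Metric.ball p R) : radialCutoff p r R x = 0 := by
  rw [mem_ball_iff_norm, not_lt] at hx
  refine Real.smoothTransition.zero_of_nonpos (div_nonpos_of_nonpos_of_nonneg ?_ ?_) <;>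
    nlinarith

theorem radialCutoff_eq_one (hr : 0 < r) (hR : r < R) {x : EuclideanSpace ℝ (Fin k)}
    (hx : x ∈ Metric.ball p r) : radialCutoff p r R x = 1 := by
  rw [mem_ball_iff_norm] at hx
  refine Real.smoothTransition.one_of_one_le ?_
  rw [le_div_iff₀ (by nlinarith)]
  nlinarith [norm_nonneg (x - p)]

theorem hasCompactSupport_radialCutoff (hr : 0 < r) (hR : r < R) :
    HasCompactSupport (radialCutoff p r R) :=
  HasCompactSupport.intro (isCompact_closedBall p R) fun _ hx =>
    radialCutoff_eq_zero hr hR fun h => hx (Metric.ball_subset_closedBall h)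

/-- The superlevel sets of the cutoff are balls, possibly empty (for `s ≤ 0`). -/
theorem exists_setOf_lt_radialCutoff_eq_ball (hr : 0 < r) (hR : r < R) {t : ℝ} (ht : 0 < t) :
    ∃ s ≤ R, {x | t < radialCutoff p r R x} = Metric.ball p s := by
  have hd : 0 < R ^ 2 - r ^ 2 := by nlinarith
  set A : Set ℝ := {u | t < Real.smoothTransition u} with hA
  have hAo : IsOpen A := isOpen_lt continuous_const Real.smoothTransition.continuous
  have hA0 : ∀ u ∈ A, 0 ≤ u := fun u hu => by
    by_contra hlt
    have : t < Real.smoothTransition u := hu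
    rw [Real.smoothTransition.zero_of_nonpos (not_le.1 hlt).le] at this
    linarith
  rcases A.eq_empty_or_nonempty with he | hne
  · refine ⟨0, by linarith, ?_⟩
    rw [Metric.ball_zero]
    refine Set.eq_empty_of_forall_notMem fun x hx => ?_
    have : (R ^ 2 - ‖x - p‖ ^ 2) / (R ^ 2 - r ^ 2) ∈ A := hx
    simp [he] at this
  · have hbdd : BddBelow A := ⟨0, fun u hu => hA0 u hu⟩
    have hmem : ∀ u, u ∈ A ↔ sInf A < u := by
      intro u
      constructor
      · intro hu
        obtain ⟨l, hl, hlA⟩ := exists_Ioc_subset_of_mem_nhds (hAo.mem_nhds hu) ⟨u - 1, by linarith⟩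
        have : (l + u) / 2 ∈ A := hlA ⟨by linarith, by linarith⟩
        have := csInf_le hbdd this
        linarith
      · intro hu
        obtain ⟨w, hw, hwu⟩ := exists_lt_of_csInf_lt hne hu
        exact lt_of_lt_of_le (show t < Real.smoothTransition w from hw)
          (Real.smoothTransition.monotone hwu.le)
    have ha0 : 0 ≤ sInf A := le_csInf hne hA0
    refine ⟨Real.sqrt (R ^ 2 - sInf A * (R ^ 2 - r ^ 2)), ?_, ?_⟩
    · rw [Real.sqrt_le_iff]
      exact ⟨by linarith, by nlinarith⟩
    · ext x
      change (R ^ 2 - ‖x - p‖ ^ 2) / (R ^ 2 - r ^ 2) ∈ A ↔ _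
      rw [hmem, mem_ball_iff_norm, Real.lt_sqrt (norm_nonneg _), lt_div_iff₀ hd]
      constructor <;> intro h <;> linarith

theorem abs_fderiv_radialCutoff_le {K : ℝ} (hK : ∀ x, |deriv Real.smoothTransition x| ≤ K)
    (hr : 0 < r) (hR : r < R) {w : EuclideanSpace ℝ (Fin k)} (hw : ‖w‖ = 1)
    {x : EuclideanSpace ℝ (Fin k)} (hx : x ∈ Metric.ball p R) :
    |fderiv ℝ (radialCutoff p r R) x w| ≤ 2 * K / (R - r) := by
  have hd : 0 < R ^ 2 - r ^ 2 := by nlinarith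
  have hRr : 0 < R - r := by linarith
  have hK0 : 0 ≤ K := (abs_nonneg _).trans (hK 0)
  have h1 : HasFDerivAt (fun x : EuclideanSpace ℝ (Fin k) => ‖x - p‖ ^ 2)
      (2 • (innerSL ℝ (x - p))) x := by
    simpa using ((hasFDerivAt_id x).sub_const p).norm_sq
  have h2 := ((h1.const_sub (R ^ 2)).mul_const (R ^ 2 - r ^ 2)⁻¹)
  have h3 := ((Real.smoothTransition.contDiff (n := 1)).differentiable one_ne_zero
    ((R ^ 2 - ‖x - p‖ ^ 2) * (R ^ 2 - r ^ 2)⁻¹)).hasDerivAt.comp_hasFDerivAt x h2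
  have h4 : fderiv ℝ (radialCutoff p r R) x = _ := HasFDerivAt.fderiv h3
  rw [h4]
  rw [mem_ball_iff_norm] at hx
  have h5 : |inner ℝ (x - p) w| ≤ R := by
    have := abs_real_inner_le_norm (x - p) w
    rw [hw, mul_one] at this
    linarith
  simp only [smul_apply, neg_apply, smul_eq_mul,
    innerSL_apply_apply, nsmul_eq_mul, abs_mul, abs_neg, abs_inv, abs_of_pos hd]
  norm_num
  calc _ ≤ K * ((R ^ 2 - r ^ 2)⁻¹ * (2 * R)) := by
        gcongr
        exact hK _
    _ ≤ 2 * K / (R - r) := by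
        rw [le_div_iff₀ hRr]
        have : R ^ 2 - r ^ 2 = (R - r) * (R + r) := by ring
        rw [this, mul_inv]
        have hRp : 0 < R + r := by linarith
        have : R * (R + r)⁻¹ ≤ 1 := by
          rw [← div_eq_mul_inv, div_le_one hRp]
          linarith
        calc _ = 2 * K * (R * (R + r)⁻¹) * ((R - r)⁻¹ * (R - r)) := by ring
          _ = 2 * K * (R * (R + r)⁻¹) := by rw [inv_mul_cancel₀ hRr.ne', mul_one]
          _ ≤ 2 * K * 1 := by gcongr
          _ = 2 * K := mul_one _

theorem fderiv_radialCutoff_eq_zero (hr : 0 < r) (hR : r < R) {x : EuclideanSpace ℝ (Fin k)}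
    (hx : x ∉ Metric.ball p R) : fderiv ℝ (radialCutoff p r R) x = 0 := by
  refine IsLocalMin.fderiv_eq_zero (Eventually.of_forall fun y => ?_)
  rw [radialCutoff_eq_zero hr hR hx]
  exact radialCutoff_nonneg y

/-- A layer-cake argument: a density with nonnegative mass on all concentric balls has nonnegative
integral against a radially decreasing weight. -/
theorem integral_radialCutoff_mul_nonneg {μ : Measure (EuclideanSpace ℝ (Fin k))}
    {f : EuclideanSpace ℝ (Fin k) → ℝ} (hfm : Measurable f) (hr : 0 < r) (hR : r < R)
    (hf : IntegrableOn f (Metric.ball p R) μ)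
    (hpos : ∀ s, 0 < s → s ≤ R → 0 ≤ ∫ x in Metric.ball p s, f x ∂μ) :
    0 ≤ ∫ x, radialCutoff p r R x * f x ∂μ := by
  have hcont : Continuous (radialCutoff p r R) := contDiff_radialCutoff.continuous
  -- The positive and negative parts of `f` are compared as densities, on every superlevel set of
  -- the cutoff.
  set m := μ.restrict (Metric.ball p R) with hm
  have hrestr : ∫ x, radialCutoff p r R x * f x ∂μ = ∫ x, radialCutoff p r R x * f x ∂m := by
    rw [hm, setIntegral_eq_integral_of_forall_compl_eq_zero]
    intro x hx
    rw [radialCutoff_eq_zero hr hR hx, zero_mul]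
  rw [hrestr]
  have hball : ∀ s ≤ R, ∫⁻ x in Metric.ball p s, ENNReal.ofReal (-f x) ∂m ≤
      ∫⁻ x in Metric.ball p s, ENNReal.ofReal (f x) ∂m := by
    intro s hs
    rcases le_or_gt s 0 with h0 | h0
    · simp [Metric.ball_eq_empty.2 h0]
    have hsub : m.restrict (Metric.ball p s) = μ.restrict (Metric.ball p s) := by
      rw [hm, Measure.restrict_restrict Metric.isOpen_ball.measurableSet,
        Set.inter_eq_left.2 (Metric.ball_subset_ball hs)]
    have hfs : IntegrableOn f (Metric.ball p s) μ := hf.mono_set (Metric.ball_subset_ball hs)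
    have h1 := hpos s h0 hs
    rw [integral_eq_lintegral_pos_part_sub_lintegral_neg_part hfs, sub_nonneg] at h1
    rw [hsub]
    exact (ENNReal.toReal_le_toReal hfs.neg.lintegral_lt_top.ne hfs.lintegral_lt_top.ne).1 h1
  have hlayer : ∀ g : EuclideanSpace ℝ (Fin k) → ℝ, Measurable g →
      ∫⁻ x, ENNReal.ofReal (radialCutoff p r R x * g x) ∂m =
        ∫⁻ t in Set.Ioi (0 : ℝ), ∫⁻ x in {x | t < radialCutoff p r R x},
          ENNReal.ofReal (g x) ∂m := by
    intro g hg
    have h1 : ∫⁻ x, ENNReal.ofReal (radialCutoff p r R x * g x) ∂m =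
        ∫⁻ x, ENNReal.ofReal (radialCutoff p r R x)
          ∂(m.withDensity fun x => ENNReal.ofReal (g x)) := by
      rw [lintegral_withDensity_eq_lintegral_mul _ hg.ennreal_ofReal
        hcont.measurable.ennreal_ofReal]
      refine lintegral_congr fun x => ?_
      rw [Pi.mul_apply, ENNReal.ofReal_mul (radialCutoff_nonneg x), mul_comm]
    rw [h1, lintegral_eq_lintegral_meas_lt _ (Eventually.of_forall radialCutoff_nonneg)
      hcont.aemeasurable]
    refine lintegral_congr fun t => ?_
    rw [withDensity_apply _ (measurableSet_lt measurable_const hcont.measurable)]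
  have hint : Integrable (fun x => radialCutoff p r R x * f x) m := by
    refine Integrable.bdd_mul (c := 1) hf hcont.aestronglyMeasurable ?_
    refine Eventually.of_forall fun x => ?_
    rw [Real.norm_eq_abs, abs_of_nonneg (radialCutoff_nonneg x)]
    exact Real.smoothTransition.le_one _
  rw [integral_eq_lintegral_pos_part_sub_lintegral_neg_part hint, sub_nonneg]
  refine ENNReal.toReal_mono hint.lintegral_lt_top.ne ?_
  simp_rw [← mul_neg]
  rw [hlayer f hfm, hlayer (fun x => -f x) hfm.neg]
  refine setLIntegral_mono' measurableSet_Ioi fun t ht => ?_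
  obtain ⟨s, hs, hset⟩ := exists_setOf_lt_radialCutoff_eq_ball (p := p) hr hR ht
  rw [hset]
  exact hball s hs

variable {E : Set (EuclideanSpace ℝ (Fin k))} {μ : Measure (EuclideanSpace ℝ (Fin k))}
  {σ : EuclideanSpace ℝ (Fin k) → EuclideanSpace ℝ (Fin k)}

/-- A Caccioppoli-type estimate: where `Dχ_E` points on average in the direction `ν` on all balls
around `p`, its total variation is controlled by the volume of `E`. -/
theorem IsPolarDerivative.exists_measureReal_ball_le (hP : IsPolarDerivative E μ σ)
    (hE : MeasurableSet E) {ν : EuclideanSpace ℝ (Fin k)} (hν : ‖ν‖ = 1) {R₀ : ℝ}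
    (hgood : ∀ s, 0 < s → s < R₀ → 0 ≤ ∫ x in Metric.ball p s, (2 * inner ℝ ν (σ x) - 1) ∂μ) :
    ∃ L : ℝ, 0 < L ∧ ∀ r R : ℝ, 0 < r → r < R → R < R₀ →
      μ.real (Metric.ball p r) ≤ L / (R - r) * volume.real (E ∩ Metric.ball p R) := by
  obtain ⟨K, hK0, hK⟩ := exists_bound_deriv_smoothTransition
  refine ⟨4 * K, by positivity, fun r R hr hR hR₀ => ?_⟩
  have := hP.locallyFinite
  have hRr : 0 < R - r := by linarith
  have hσ := hP.measurable
  have hcs := hasCompactSupport_radialCutoff (p := p) hr hR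
  have hcd := contDiff_radialCutoff (p := p) (r := r) (R := R)
  -- `∫ φ dμ ≤ 2 ∫ φ ⟪ν, σ⟫ dμ = -2 ∫_E ∂_ν φ` for the radial cutoff `φ`.
  have hpos := integral_radialCutoff_mul_nonneg (p := p) (μ := μ)
    (f := fun x => 2 * inner ℝ ν (σ x) - 1) (by fun_prop) hr hR
    (((hP.integrableOn_inner p ν R).const_mul 2).sub
      (integrableOn_const measure_ball_lt_top.ne))
    fun s h0 hs => hgood s h0 (hs.trans_lt hR₀)
  have hi1 := integrable_mul_inner_of_hasCompactSupport hP hcd.continuous hcs ν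
  have hi2 : Integrable (radialCutoff p r R) μ :=
    hcd.continuous.integrable_of_hasCompactSupport hcs
  have hsplit : ∫ x, radialCutoff p r R x * (2 * inner ℝ ν (σ x) - 1) ∂μ =
      2 * (∫ x, radialCutoff p r R x * inner ℝ ν (σ x) ∂μ) - ∫ x, radialCutoff p r R x ∂μ := by
    rw [← integral_const_mul, ← integral_sub (hi1.const_mul 2) hi2]
    congr 1
    ext x
    ring
  have hleft : μ.real (Metric.ball p r) ≤ ∫ x, radialCutoff p r R x ∂μ := by
    rw [← integral_indicator_one Metric.isOpen_ball.measurableSet]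
    refine integral_mono ((integrable_indicator_iff Metric.isOpen_ball.measurableSet).2
      (integrableOn_const measure_ball_lt_top.ne)) hi2 fun x => ?_
    by_cases hx : x ∈ Metric.ball p r
    · simp [Set.indicator_of_mem hx, radialCutoff_eq_one hr hR hx]
    · rw [Set.indicator_of_notMem hx]
      exact radialCutoff_nonneg x
  have hright : -∫ x in E, fderiv ℝ (radialCutoff p r R) x ν ≤
      2 * K / (R - r) * volume.real (E ∩ Metric.ball p R) := by
    have hzero : ∫ x in E, fderiv ℝ (radialCutoff p r R) x ν =
        ∫ x in E ∩ Metric.ball p R, fderiv ℝ (radialCutoff p r R) x ν := by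
      refine setIntegral_eq_of_subset_of_forall_sdiff_eq_zero hE Set.inter_subset_left ?_
      intro x hx
      have : x ∉ Metric.ball p R := fun h => hx.2 ⟨hx.1, h⟩
      simp [fderiv_radialCutoff_eq_zero hr hR this]
    rw [hzero]
    exact (neg_le_abs _).trans (norm_setIntegral_le_of_norm_le_const
      (f := fun x => fderiv ℝ (radialCutoff p r R) x ν)
      ((measure_mono Set.inter_subset_right).trans_lt measure_ball_lt_top)
      fun x hx => abs_fderiv_radialCutoff_le hK hr hR hν hx.2)
  rw [hP.setIntegral_fderiv hcd hcs ν, neg_neg] at hright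
  rw [hsplit] at hpos
  calc μ.real (Metric.ball p r) ≤ 2 * (2 * K / (R - r) * volume.real (E ∩ Metric.ball p R)) := by
        linarith
    _ = _ := by ring

end Radial

/-! ### Isoperimetric inequality and volume density -/

section Density

variable {k : ℕ}

theorem volume_real_ball (p : EuclideanSpace ℝ (Fin k)) {s : ℝ} (hs : 0 < s) :
    volume.real (Metric.ball p s) =
      s ^ k * volume.real (Metric.ball (0 : EuclideanSpace ℝ (Fin k)) 1) := by
  simp only [measureReal_def]
  rw [Measure.addHaar_ball_of_pos _ _ hs, ENNReal.toReal_mul,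
    ENNReal.toReal_ofReal (by positivity), finrank_euclideanSpace_fin]

theorem volume_real_unitBall_pos :
    0 < volume.real (Metric.ball (0 : EuclideanSpace ℝ (Fin k)) 1) :=
  ENNReal.toReal_pos (Metric.measure_ball_pos _ _ one_pos).ne' measure_ball_lt_top.ne

/-- Double counting of the pairs `(x, h) ∈ X × H` with `x + h ∈ Y`. -/
theorem mul_volume_le_of_translate {X Y H : Set (EuclideanSpace ℝ (Fin k))}
    (hX : MeasurableSet X) (hY : MeasurableSet Y) (hH : MeasurableSet H)
    (hXfin : volume X ≠ ⊤) (hHfin : volume H ≠ ⊤) {M N : ℝ} (hM0 : 0 ≤ M)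
    (hM : ∀ h ∈ H, volume.real {x | x ∈ X ∧ x + h ∈ Y} ≤ M)
    (hN : ∀ x ∈ X, N ≤ volume.real {h | h ∈ H ∧ x + h ∈ Y}) :
    N * volume.real X ≤ M * volume.real H := by
  set Z : Set (EuclideanSpace ℝ (Fin k) × EuclideanSpace ℝ (Fin k)) := {z | z.1 + z.2 ∈ Y} with hZ
  have hZm : MeasurableSet Z := (measurable_fst.add measurable_snd) hY
  have h1 := Measure.prod_apply (μ := volume.restrict X) (ν := volume.restrict H) hZm
  rw [Measure.prod_apply_symm hZm] at h1
  have h2 : ENNReal.ofReal N * volume X ≤ ENNReal.ofReal M * volume H := by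
    calc ENNReal.ofReal N * volume X = ∫⁻ _ in X, ENNReal.ofReal N := by simp
      _ ≤ ∫⁻ x in X, volume.restrict H (Prod.mk x ⁻¹' Z) := by
        refine setLIntegral_mono' hX fun x hx => ?_
        rw [Measure.restrict_apply (measurable_prodMk_left hZm)]
        refine ENNReal.ofReal_le_of_le_toReal ((hN x hx).trans_eq ?_)
        rw [measureReal_def]
        congr 2
        ext h
        exact and_comm
      _ = ∫⁻ h in H, volume.restrict X ((fun x => (x, h)) ⁻¹' Z) := h1.symm
      _ ≤ ∫⁻ _ in H, ENNReal.ofReal M := by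
        refine setLIntegral_mono' hH fun h hh => ?_
        rw [Measure.restrict_apply (measurable_prodMk_right hZm)]
        rw [← ENNReal.ofReal_toReal (a := volume ((fun x => (x, h)) ⁻¹' Z ∩ X))
          (measure_ne_top_of_subset Set.inter_subset_right hXfin)]
        refine ENNReal.ofReal_le_ofReal (Eq.trans_le ?_ (hM h hh))
        rw [measureReal_def]
        congr 2
        ext x
        exact and_comm
      _ = ENNReal.ofReal M * volume H := by simp
  rcases le_or_gt N 0 with hN0 | hN0
  · exact (mul_nonpos_of_nonpos_of_nonneg hN0 measureReal_nonneg).trans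
      (mul_nonneg hM0 measureReal_nonneg)
  · have h3 := ENNReal.toReal_mono (by finiteness) h2
    rwa [ENNReal.toReal_mul, ENNReal.toReal_mul, ENNReal.toReal_ofReal hN0.le,
      ENNReal.toReal_ofReal hM0] at h3

variable {E : Set (EuclideanSpace ℝ (Fin k))} {μ : Measure (EuclideanSpace ℝ (Fin k))}
  {σ : EuclideanSpace ℝ (Fin k) → EuclideanSpace ℝ (Fin k)}

/-- A local isoperimetric inequality: a set filling at most half of a ball of radius `s` loses
half of its mass under the average translation of length less than `s`. -/
theorem IsPolarDerivative.volume_inter_ball_le (hP : IsPolarDerivative E μ σ)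
    (hE : MeasurableSet E) (p : EuclideanSpace ℝ (Fin k)) {r s : ℝ} (hs : 0 < s)
    (hhalf : volume.real (E ∩ Metric.ball p (r + s)) ≤
      volume.real (Metric.ball (0 : EuclideanSpace ℝ (Fin k)) s) / 2) :
    volume.real (E ∩ Metric.ball p r) ≤ 2 * s * μ.real (Metric.ball p (r + s)) := by
  have := hP.locallyFinite
  have hball := fun (q : EuclideanSpace ℝ (Fin k)) (t : ℝ) =>
    (Metric.isOpen_ball (x := q) (ε := t)).measurableSet
  have hfin : ∀ (q : EuclideanSpace ℝ (Fin k)) (t : ℝ), volume (E ∩ Metric.ball q t) ≠ ⊤ :=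
    fun q t => measure_ne_top_of_subset Set.inter_subset_right measure_ball_lt_top.ne
  have hω : 0 < volume.real (Metric.ball (0 : EuclideanSpace ℝ (Fin k)) s) :=
    ENNReal.toReal_pos (Metric.measure_ball_pos _ _ hs).ne' measure_ball_lt_top.ne
  have key := mul_volume_le_of_translate (X := E ∩ Metric.ball p r) (Y := Eᶜ)
    (H := Metric.ball (0 : EuclideanSpace ℝ (Fin k)) s)
    (M := s * μ.real (Metric.ball p (r + s)))
    (N := volume.real (Metric.ball (0 : EuclideanSpace ℝ (Fin k)) s) / 2)
    (hE.inter (hball _ _)) hE.compl (hball _ _) (hfin _ _) measure_ball_lt_top.ne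
    (mul_nonneg hs.le measureReal_nonneg) ?_ ?_
  · have : volume.real (Metric.ball (0 : EuclideanSpace ℝ (Fin k)) s) *
        volume.real (E ∩ Metric.ball p r) ≤
        volume.real (Metric.ball (0 : EuclideanSpace ℝ (Fin k)) s) *
        (2 * s * μ.real (Metric.ball p (r + s))) := by linarith
    exact le_of_mul_le_mul_left this hω
  · intro h hh
    rw [mem_ball_zero_iff] at hh
    have h1 := hP.volume_shift_le hE p r h
    have hset : {x | x ∈ E ∩ Metric.ball p r ∧ x + h ∈ Eᶜ} =
        {x | (x ∈ Metric.ball p r ∧ x ∈ E) ∧ x + h ∉ E} := by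
      ext x
      simp only [Set.mem_ofPred_eq, Set.mem_inter_iff, Set.mem_compl_iff]
      tauto
    rw [hset]
    refine h1.trans ?_
    have h2 : ∫ x in Metric.ball p (r + ‖h‖), max (-inner ℝ h (σ x)) 0 ∂μ ≤
        ‖h‖ * μ.real (Metric.ball p (r + ‖h‖)) := by
      refine (le_abs_self _).trans (norm_setIntegral_le_of_norm_le_const_ae
        (f := fun x => max (-inner ℝ h (σ x)) 0) measure_ball_lt_top ?_)
      filter_upwards [ae_restrict_of_ae hP.norm_eq_one] with x hx
      rw [Real.norm_eq_abs, abs_of_nonneg (le_max_right _ _)]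
      refine max_le ?_ (norm_nonneg _)
      have := neg_le_of_abs_le (abs_real_inner_le_norm h (σ x))
      rw [hx, mul_one] at this
      linarith
    refine h2.trans ?_
    have : Metric.ball p (r + ‖h‖) ⊆ Metric.ball p (r + s) := Metric.ball_subset_ball (by linarith)
    gcongr
    exact measure_ball_lt_top.ne
  · intro x hx
    have hx' := hx.2
    rw [mem_ball_iff_norm] at hx'
    have hY : MeasurableSet {h | x + h ∈ E} := (measurable_const_add x) hE
    have h1 := measureReal_inter_add_sdiff (μ := volume)
      (s := Metric.ball (0 : EuclideanSpace ℝ (Fin k)) s) hY measure_ball_lt_top.ne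
    have h2 : volume.real (Metric.ball (0 : EuclideanSpace ℝ (Fin k)) s ∩ {h | x + h ∈ E}) ≤
        volume.real (E ∩ Metric.ball p (r + s)) := by
      rw [measureReal_def, measureReal_def, ← measure_preimage_add volume x
        (E ∩ Metric.ball p (r + s))]
      refine ENNReal.toReal_mono ?_ (measure_mono ?_)
      · rw [measure_preimage_add]
        exact hfin _ _
      · rintro h ⟨hh, hxh⟩
        refine ⟨hxh, ?_⟩
        rw [mem_ball_zero_iff] at hh
        rw [mem_ball_iff_norm]
        calc ‖x + h - p‖ = ‖(x - p) + h‖ := by congr 1; abel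
          _ ≤ ‖x - p‖ + ‖h‖ := norm_add_le _ _
          _ < r + s := by linarith
    have h3 : {h | h ∈ Metric.ball (0 : EuclideanSpace ℝ (Fin k)) s ∧ x + h ∈ Eᶜ} =
        Metric.ball (0 : EuclideanSpace ℝ (Fin k)) s \ {h | x + h ∈ E} := rfl
    rw [h3]
    linarith

/-- The lower volume density estimate at points with a measure-theoretic normal. If `E` had very
small density in a ball of radius `ρ`, the isoperimetric inequality and the Caccioppoli estimate
could be iterated on shrinking balls to show that `E` is null in the ball of radius `ρ / 2`. -/
theorem IsPolarDerivative.exists_volume_ball_ge (hk : k ≠ 0) (hP : IsPolarDerivative E μ σ)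
    (hE : MeasurableSet E) {p ν : EuclideanSpace ℝ (Fin k)} (hν : ‖ν‖ = 1) {R₀ : ℝ}
    (hgood : ∀ s, 0 < s → s < R₀ → 0 ≤ ∫ x in Metric.ball p s, (2 * inner ℝ ν (σ x) - 1) ∂μ)
    (hpos : ∀ s, 0 < s → s < R₀ → 0 < μ.real (Metric.ball p s)) :
    ∃ c : ℝ, 0 < c ∧ ∀ ρ, 0 < ρ → ρ < R₀ → c * ρ ^ k < volume.real (E ∩ Metric.ball p ρ) := by
  obtain ⟨L, hL, hLb⟩ := hP.exists_measureReal_ball_le hE hν hgood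
  have hfin : ∀ (q : EuclideanSpace ℝ (Fin k)) (t : ℝ), volume (E ∩ Metric.ball q t) ≠ ⊤ :=
    fun q t => measure_ne_top_of_subset Set.inter_subset_right measure_ball_lt_top.ne
  set ω := volume.real (Metric.ball (0 : EuclideanSpace ℝ (Fin k)) 1) with hωdef
  have hω : 0 < ω := volume_real_unitBall_pos
  -- `l` is the ratio of the translation length to the gap between consecutive radii.
  obtain ⟨l, hl0, hl2, hlL⟩ : ∃ l : ℝ, 0 < l ∧ l ≤ 1 / 2 ∧ 4 * l * L ≤ (1 / 2) ^ k := by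
    refine ⟨min (1 / 2) ((1 / 2) ^ k / (4 * L)), by positivity, min_le_left _ _, ?_⟩
    calc 4 * min (1 / 2) ((1 / 2) ^ k / (4 * L)) * L ≤ 4 * ((1 / 2) ^ k / (4 * L)) * L := by
          gcongr
          exact min_le_right _ _
      _ = (1 / 2) ^ k := by field_simp
  have hstep : ∀ r d : ℝ, 0 < r → 0 < d → r + d < R₀ →
      volume.real (E ∩ Metric.ball p (r + d)) ≤ ω / 2 * (l * d) ^ k →
      volume.real (E ∩ Metric.ball p r) ≤
        (1 / 2) ^ k * volume.real (E ∩ Metric.ball p (r + d)) := by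
    intro r d hr hd hrd hsmall
    have hld : 0 < l * d := by positivity
    have hldd : l * d ≤ 1 / 2 * d := by gcongr
    have h1 := hP.volume_inter_ball_le hE p (r := r) hld (by
      rw [volume_real_ball _ hld]
      refine (measureReal_mono (Set.inter_subset_inter_right _
        (Metric.ball_subset_ball (by linarith))) (hfin _ _)).trans (hsmall.trans_eq ?_)
      ring)
    have h2 := hLb (r + l * d) (r + d) (by positivity) (by linarith) hrd
    have h3 : L / (r + d - (r + l * d)) ≤ L / (1 / 2 * d) := by
      gcongr
      linarith
    calc volume.real (E ∩ Metric.ball p r) ≤ 2 * (l * d) * μ.real (Metric.ball p (r + l * d)) := h1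
      _ ≤ 2 * (l * d) * (L / (1 / 2 * d) * volume.real (E ∩ Metric.ball p (r + d))) := by
        gcongr
        exact h2.trans (by gcongr)
      _ = 4 * l * L * volume.real (E ∩ Metric.ball p (r + d)) := by
        field_simp
        ring
      _ ≤ _ := by gcongr
  refine ⟨ω / 2 * (l / 4) ^ k, by positivity, fun ρ hρ hρR => ?_⟩
  by_contra! hsmall
  -- The radii `ρ / 2 + ρ / 2 ^ (j + 1)` decrease from `ρ` to `ρ / 2`.
  have hiter : ∀ j : ℕ, volume.real (E ∩ Metric.ball p (ρ / 2 + ρ / 2 * (1 / 2) ^ j)) ≤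
      ω / 2 * (l * (ρ / 4 * (1 / 2) ^ j)) ^ k := by
    intro j
    induction j with
    | zero =>
      have : ρ / 2 + ρ / 2 * (1 / 2) ^ 0 = ρ := by ring
      rw [this]
      refine hsmall.trans_eq ?_
      rw [mul_assoc, ← mul_pow]
      congr 2
      ring
    | succ j ih =>
      have hpj : (0 : ℝ) < (1 / 2) ^ j := by positivity
      have hpj1 : ((1 : ℝ) / 2) ^ j ≤ 1 := pow_le_one₀ (by norm_num) (by norm_num)
      have hrad : ρ / 2 + ρ / 2 * (1 / 2) ^ j =
          (ρ / 2 + ρ / 2 * (1 / 2) ^ (j + 1)) + ρ / 4 * (1 / 2) ^ j := by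
        rw [pow_succ]
        ring
      have h1 := hstep (ρ / 2 + ρ / 2 * (1 / 2) ^ (j + 1)) (ρ / 4 * (1 / 2) ^ j) (by positivity)
        (by positivity) (by rw [← hrad]; nlinarith) (by rw [← hrad]; exact ih)
      rw [← hrad] at h1
      refine h1.trans ?_
      calc _ ≤ (1 / 2) ^ k * (ω / 2 * (l * (ρ / 4 * (1 / 2) ^ j)) ^ k) := by gcongr
        _ = ω / 2 * (1 / 2 * (l * (ρ / 4 * (1 / 2) ^ j))) ^ k := by rw [mul_pow (1 / 2)]; ring
        _ = _ := by
          congr 2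
          rw [pow_succ]
          ring
  have hpow : ∀ j : ℕ, volume.real (E ∩ Metric.ball p (ρ / 2)) ≤
      volume.real (E ∩ Metric.ball p (ρ / 2 + ρ / 2 * (1 / 2) ^ j)) := fun j =>
    measureReal_mono (Set.inter_subset_inter_right _ (Metric.ball_subset_ball
      (le_add_of_nonneg_right (by positivity)))) (hfin _ _)
  have hzero : volume.real (E ∩ Metric.ball p (ρ / 2)) = 0 := by
    refine le_antisymm ?_ measureReal_nonneg
    have hlim : Tendsto (fun j : ℕ => ω / 2 * (l * (ρ / 4 * (1 / 2 : ℝ) ^ j)) ^ k) atTop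
        (𝓝 (ω / 2 * (l * (ρ / 4 * 0)) ^ k)) :=
      (((tendsto_pow_atTop_nhds_zero_of_lt_one (by norm_num) (by norm_num)).const_mul _).const_mul
        _).pow k |>.const_mul _
    rw [mul_zero, mul_zero, zero_pow hk, mul_zero] at hlim
    exact ge_of_tendsto' hlim fun j => (hpow j).trans (hiter j)
  have := hLb (ρ / 4) (ρ / 2) (by positivity) (by linarith) (by linarith)
  rw [hzero, mul_zero] at this
  linarith [hpos (ρ / 4) (by positivity) (by linarith)]

end Density

/-! ### Blow-up at points with a normal -/

section BlowUp

variable {k : ℕ} {E : Set (EuclideanSpace ℝ (Fin k))} {μ : Measure (EuclideanSpace ℝ (Fin k))}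
  {σ : EuclideanSpace ℝ (Fin k) → EuclideanSpace ℝ (Fin k)} {p ν : EuclideanSpace ℝ (Fin k)}

theorem IsPolarDerivative.eventually_integral_one_sub_inner_le (hP : IsPolarDerivative E μ σ)
    (hν : ‖ν‖ = 1)
    (hlim : Tendsto (fun ρ => (μ.real (Metric.ball p ρ))⁻¹ • ∫ y in Metric.ball p ρ, σ y ∂μ)
      (𝓝[>] 0) (𝓝 ν)) {ε : ℝ} (hε : 0 < ε) :
    ∀ᶠ ρ in 𝓝[>] (0 : ℝ), 0 < μ.real (Metric.ball p ρ) ∧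
      ∫ y in Metric.ball p ρ, (1 - inner ℝ ν (σ y)) ∂μ ≤ ε * μ.real (Metric.ball p ρ) := by
  have := hP.locallyFinite
  have h1 : Tendsto (fun ρ => inner ℝ ν ((μ.real (Metric.ball p ρ))⁻¹ •
      ∫ y in Metric.ball p ρ, σ y ∂μ)) (𝓝[>] 0) (𝓝 1) := by
    have := (tendsto_const_nhds (x := ν)).inner (𝕜 := ℝ) hlim
    rwa [real_inner_self_eq_norm_sq, hν, one_pow] at this
  filter_upwards [h1.eventually (lt_mem_nhds (show (1 : ℝ) - ε < 1 by linarith)),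
    h1.eventually (lt_mem_nhds one_pos)] with ρ h2 h3
  rw [real_inner_smul_right] at h2 h3
  have hm : 0 < μ.real (Metric.ball p ρ) := by
    rcases (measureReal_nonneg (μ := μ) (s := Metric.ball p ρ)).eq_or_lt with h | h
    · simp [← h] at h3
    · exact h
  refine ⟨hm, ?_⟩
  have h4 : ∫ y in Metric.ball p ρ, (1 - inner ℝ ν (σ y)) ∂μ =
      μ.real (Metric.ball p ρ) - inner ℝ ν (∫ y in Metric.ball p ρ, σ y ∂μ) := by
    have hc : IntegrableOn (fun _ => (1 : ℝ)) (Metric.ball p ρ) μ :=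
      integrableOn_const measure_ball_lt_top.ne
    rw [integral_sub hc (hP.integrableOn_inner p ν ρ), integral_inner (hP.integrableOn_ball p ρ)]
    simp
  rw [h4]
  rw [lt_inv_mul_iff₀ hm] at h2
  linarith

/-- The averaged condition defining the normal holds with a definite constant on all small
balls. -/
theorem IsPolarDerivative.exists_good_radius (hP : IsPolarDerivative E μ σ)
    (hν : ‖ν‖ = 1)
    (hlim : Tendsto (fun ρ => (μ.real (Metric.ball p ρ))⁻¹ • ∫ y in Metric.ball p ρ, σ y ∂μ)
      (𝓝[>] 0) (𝓝 ν)) :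
    ∃ R₀ > 0, (∀ s, 0 < s → s < R₀ →
      0 ≤ ∫ x in Metric.ball p s, (2 * inner ℝ ν (σ x) - 1) ∂μ) ∧
      ∀ s, 0 < s → s < R₀ → 0 < μ.real (Metric.ball p s) := by
  have := hP.locallyFinite
  obtain ⟨R₀, hR₀, hsub⟩ := mem_nhdsGT_iff_exists_Ioo_subset.1
    (hP.eventually_integral_one_sub_inner_le hν hlim (show (0 : ℝ) < 1 / 2 by norm_num))
  refine ⟨R₀, hR₀, fun s h0 hs => ?_, fun s h0 hs => (hsub ⟨h0, hs⟩).1⟩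
  have h1 := (hsub ⟨h0, hs⟩).2
  have h2 : ∫ x in Metric.ball p s, (2 * inner ℝ ν (σ x) - 1) ∂μ =
      μ.real (Metric.ball p s) - 2 * ∫ y in Metric.ball p s, (1 - inner ℝ ν (σ y)) ∂μ := by
    have hi := hP.integrableOn_inner p ν s
    have hc : IntegrableOn (fun _ => (1 : ℝ)) (Metric.ball p s) μ :=
      integrableOn_const measure_ball_lt_top.ne
    rw [integral_sub (hi.const_mul 2) hc, integral_sub hc hi, integral_const_mul]
    simp
    ring
  rw [h2]
  linarith

/-- The excess `∫_{B_ρ} (1 - ⟪ν, σ⟫) d|Dχ_E|` is of lower order than `ρ ^ (k - 1)`. -/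
theorem IsPolarDerivative.eventually_mul_integral_le (hP : IsPolarDerivative E μ σ)
    (hE : MeasurableSet E) (hν : ‖ν‖ = 1)
    (hlim : Tendsto (fun ρ => (μ.real (Metric.ball p ρ))⁻¹ • ∫ y in Metric.ball p ρ, σ y ∂μ)
      (𝓝[>] 0) (𝓝 ν)) {ε : ℝ} (hε : 0 < ε) :
    ∀ᶠ ρ in 𝓝[>] (0 : ℝ),
      ρ * ∫ y in Metric.ball p ρ, (1 - inner ℝ ν (σ y)) ∂μ ≤ ε * ρ ^ k := by
  obtain ⟨R₀, hR₀, hgood, -⟩ := hP.exists_good_radius hν hlim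
  obtain ⟨L, hL, hLb⟩ := hP.exists_measureReal_ball_le hE hν hgood
  set ω := volume.real (Metric.ball (0 : EuclideanSpace ℝ (Fin k)) 1) with hωdef
  have hω : 0 < ω := volume_real_unitBall_pos
  filter_upwards [hP.eventually_integral_one_sub_inner_le hν hlim
    (show 0 < ε / (L * 2 ^ k * ω) by positivity), self_mem_nhdsWithin,
    nhdsWithin_le_nhds (gt_mem_nhds (show 0 < R₀ / 2 by linarith))] with ρ h1 hρ hρR
  have hρ0 : 0 < ρ := hρ
  have h2 := hLb ρ (2 * ρ) hρ0 (by linarith) (by linarith)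
  have h3 : volume.real (E ∩ Metric.ball p (2 * ρ)) ≤ (2 * ρ) ^ k * ω := by
    rw [hωdef, ← volume_real_ball p (by positivity)]
    exact measureReal_mono Set.inter_subset_right measure_ball_lt_top.ne
  have h4 : 2 * ρ - ρ = ρ := by ring
  rw [h4] at h2
  calc ρ * ∫ y in Metric.ball p ρ, (1 - inner ℝ ν (σ y)) ∂μ
      ≤ ρ * (ε / (L * 2 ^ k * ω) * (L / ρ * ((2 * ρ) ^ k * ω))) := by
        gcongr
        exact h1.2.trans (by gcongr; exact h2.trans (by gcongr))
    _ = ε * ρ ^ k := by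
        rw [mul_pow]
        field_simp

/-- In the cone of directions `h` with `⟪h, ν⟫ ≥ α`, a unit vector `s` can only have a negative
component along `h` at the expense of `1 - ⟪ν, s⟫`. -/
theorem max_neg_inner_le {h s : EuclideanSpace ℝ (Fin k)} (hν : ‖ν‖ = 1) (hs : ‖s‖ = 1)
    {α β : ℝ} (hα : 0 < α) (hαh : α ≤ inner ℝ h ν) (hβ : ‖h‖ ≤ β) :
    max (-inner ℝ h s) 0 ≤ 2 * β ^ 3 / α ^ 2 * (1 - inner ℝ ν s) := by
  have hβ0 : 0 ≤ β := (norm_nonneg _).trans hβ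
  have h1 : ‖ν - s‖ ^ 2 = 2 * (1 - inner ℝ ν s) := by
    rw [norm_sub_sq_real, hν, hs]
    ring
  have hrw : 2 * β ^ 3 / α ^ 2 * (1 - inner ℝ ν s) = β * (β * ‖ν - s‖ / α) ^ 2 := by
    rw [div_pow, mul_pow, h1]
    ring
  rw [hrw]
  refine max_le ?_ (by positivity)
  rcases le_or_gt 0 (inner ℝ h s : ℝ) with h0 | h0
  · have : 0 ≤ β * (β * ‖ν - s‖ / α) ^ 2 := by positivity
    linarith
  · have h2 : α ≤ β * ‖ν - s‖ := by
      calc α ≤ inner ℝ h (ν - s) := by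
            rw [inner_sub_right]
            linarith
        _ ≤ ‖h‖ * ‖ν - s‖ := real_inner_le_norm _ _
        _ ≤ β * ‖ν - s‖ := by gcongr
    have h3 : 1 ≤ β * ‖ν - s‖ / α := (one_le_div hα).2 h2
    have h4 : -inner ℝ h s ≤ β := by
      have := neg_le_of_abs_le (abs_real_inner_le_norm h s)
      rw [hs, mul_one] at this
      linarith
    calc -inner ℝ h s ≤ β := h4
      _ ≤ β * (β * ‖ν - s‖ / α) ^ 2 := le_mul_of_one_le_right hβ0 (one_le_pow₀ h3)

/-- The blow-ups of `E` fill the half-space `{e | ⟪e, ν⟫ > 0}`. Translations carrying the part of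
`E` near `p`, which has positive density, into a small ball around `p + ρ e` all point into a cone
around `ν`, hence leave `E` nearly invariant, so that almost all of that ball lies in `E`. -/
theorem IsPolarDerivative.eventually_volume_sdiff_le (hk : k ≠ 0) (hP : IsPolarDerivative E μ σ)
    (hE : MeasurableSet E) (hν : ‖ν‖ = 1)
    (hlim : Tendsto (fun ρ => (μ.real (Metric.ball p ρ))⁻¹ • ∫ y in Metric.ball p ρ, σ y ∂μ)
      (𝓝[>] 0) (𝓝 ν)) {e : EuclideanSpace ℝ (Fin k)} {t : ℝ} (ht : 0 < t)
    (hte : 4 * t ≤ inner ℝ e ν) {ε : ℝ} (hε : 0 < ε) :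
    ∀ᶠ ρ in 𝓝[>] (0 : ℝ),
      volume.real (Metric.ball (p + ρ • e) (t * ρ) \ E) ≤ ε * ρ ^ k := by
  have := hP.locallyFinite
  obtain ⟨R₀, hR₀, hgood, hpos⟩ := hP.exists_good_radius hν hlim
  obtain ⟨c, hc, hcb⟩ := hP.exists_volume_ball_ge hk hE hν hgood hpos
  have hω : 0 < volume.real (Metric.ball (0 : EuclideanSpace ℝ (Fin k)) 1) :=
    volume_real_unitBall_pos
  set ω := volume.real (Metric.ball (0 : EuclideanSpace ℝ (Fin k)) 1) with hωdef
  obtain ⟨a, ha0, ha⟩ : ∃ a : ℝ, 0 < a ∧ inner ℝ e ν = 2 * a :=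
    ⟨inner ℝ e ν / 2, by linarith, by ring⟩
  set M := ‖e‖ + 2 * t with hM
  have hM0 : 0 < M := by positivity
  have hD : 0 < 2 * M ^ 3 / a ^ 2 := by positivity
  -- The tolerance for the excess on the ball of radius `(t + M) ρ`.
  set δ := ε * c / (2 ^ k * ω * (2 * M ^ 3 / a ^ 2) * (t + M) ^ k) * (t + M) with hδ
  have hδ0 : 0 < δ := by positivity
  have hscale : Tendsto (fun ρ : ℝ => (t + M) * ρ) (𝓝[>] 0) (𝓝[>] 0) := by
    refine tendsto_nhdsWithin_iff.2 ⟨?_, ?_⟩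
    · have : Tendsto (fun ρ : ℝ => (t + M) * ρ) (𝓝 0) (𝓝 ((t + M) * 0)) :=
        tendsto_id.const_mul _
      rw [mul_zero] at this
      exact this.mono_left nhdsWithin_le_nhds
    · filter_upwards [self_mem_nhdsWithin] with ρ hρ
      exact mul_pos (show 0 < t + M by positivity) (Set.mem_Ioi.1 hρ)
  filter_upwards [hscale.eventually (hP.eventually_mul_integral_le hE hν hlim hδ0),
    self_mem_nhdsWithin, nhdsWithin_le_nhds (gt_mem_nhds (show 0 < R₀ / t by positivity))]
    with ρ hexc hρ hρR
  have hρ0 : 0 < ρ := hρ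
  have htρ : 0 < t * ρ := by positivity
  set X := ∫ y in Metric.ball p ((t + M) * ρ), (1 - inner ℝ ν (σ y)) ∂μ with hX
  have hX0 : 0 ≤ X := by
    have h : ∀ᵐ x ∂μ, 0 ≤ 1 - inner ℝ ν (σ x) := by
      filter_upwards [hP.norm_eq_one] with x hx
      have := real_inner_le_norm ν (σ x)
      rw [hν, hx, mul_one] at this
      exact sub_nonneg.2 this
    exact integral_nonneg_of_ae (ae_restrict_of_ae h)
  have key := mul_volume_le_of_translate (X := E ∩ Metric.ball p (t * ρ))
    (Y := Metric.ball (p + ρ • e) (t * ρ) \ E) (H := Metric.ball (ρ • e) (2 * (t * ρ)))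
    (M := 2 * (M * ρ) ^ 3 / (a * ρ) ^ 2 * X)
    (N := volume.real (Metric.ball (p + ρ • e) (t * ρ) \ E))
    (hE.inter Metric.isOpen_ball.measurableSet) (Metric.isOpen_ball.measurableSet.diff hE)
    Metric.isOpen_ball.measurableSet
    (measure_ne_top_of_subset Set.inter_subset_right measure_ball_lt_top.ne)
    measure_ball_lt_top.ne (by positivity) ?_ ?_
  · have hlow := hcb (t * ρ) htρ (by rwa [lt_div_iff₀ ht, mul_comm] at hρR)
    rw [volume_real_ball _ (by positivity : 0 < 2 * (t * ρ))] at key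
    have h1 : volume.real (Metric.ball (p + ρ • e) (t * ρ) \ E) * (c * (t * ρ) ^ k) ≤
        2 * (M * ρ) ^ 3 / (a * ρ) ^ 2 * X * ((2 * (t * ρ)) ^ k * ω) := by
      refine le_trans ?_ key
      gcongr
    have h2 : X ≤ δ * ((t + M) * ρ) ^ k / ((t + M) * ρ) := by
      rw [le_div_iff₀ (by positivity)]
      linarith
    have h3 : volume.real (Metric.ball (p + ρ • e) (t * ρ) \ E) * (c * (t * ρ) ^ k) ≤
        ε * ρ ^ k * (c * (t * ρ) ^ k) := by
      refine h1.trans ?_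
      calc _ ≤ 2 * (M * ρ) ^ 3 / (a * ρ) ^ 2 * (δ * ((t + M) * ρ) ^ k / ((t + M) * ρ)) *
            ((2 * (t * ρ)) ^ k * ω) := by gcongr
        _ = _ := by
          rw [hδ, mul_pow (t + M) ρ, mul_pow 2 (t * ρ)]
          field_simp
    exact le_of_mul_le_mul_right h3 (by positivity)
  · intro h hh
    rw [mem_ball_iff_norm] at hh
    have hnorm : ‖h‖ ≤ M * ρ := by
      calc ‖h‖ = ‖(h - ρ • e) + ρ • e‖ := by simp
        _ ≤ ‖h - ρ • e‖ + ‖ρ • e‖ := norm_add_le _ _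
        _ ≤ 2 * (t * ρ) + ρ * ‖e‖ := by
          rw [norm_smul, Real.norm_eq_abs, abs_of_pos hρ0]
          gcongr
        _ = M * ρ := by rw [hM]; ring
    have hcone : a * ρ ≤ inner ℝ h ν := by
      have h1 : inner ℝ h ν = inner ℝ (h - ρ • e) ν + ρ * inner ℝ e ν := by
        rw [inner_sub_left, real_inner_smul_left]
        ring
      have h2 := neg_le_of_abs_le (abs_real_inner_le_norm (h - ρ • e) ν)
      rw [hν, mul_one] at h2
      rw [h1, ha]
      rw [ha] at hte
      nlinarith
    have hfin : volume {x | (x ∈ Metric.ball p (t * ρ) ∧ x ∈ E) ∧ x + h ∉ E} ≠ ⊤ :=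
      measure_ne_top_of_subset (fun x hx => hx.1.1)
        (measure_ball_lt_top (x := p) (r := t * ρ) (μ := volume)).ne
    have hI : IntegrableOn (fun x => 1 - inner ℝ ν (σ x)) (Metric.ball p ((t + M) * ρ)) μ :=
      Integrable.sub (integrableOn_const measure_ball_lt_top.ne) (hP.integrableOn_inner p ν _)
    calc volume.real {x | x ∈ E ∩ Metric.ball p (t * ρ) ∧
          x + h ∈ Metric.ball (p + ρ • e) (t * ρ) \ E}
        ≤ volume.real {x | (x ∈ Metric.ball p (t * ρ) ∧ x ∈ E) ∧ x + h ∉ E} :=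
          measureReal_mono (fun x hx => ⟨⟨hx.1.2, hx.1.1⟩, hx.2.2⟩) hfin
      _ ≤ ∫ x in Metric.ball p (t * ρ + ‖h‖), max (-inner ℝ h (σ x)) 0 ∂μ :=
          hP.volume_shift_le hE p _ h
      _ ≤ ∫ x in Metric.ball p ((t + M) * ρ), max (-inner ℝ h (σ x)) 0 ∂μ := by
          refine setIntegral_mono_set (hP.integrableOn_negPart p h _)
            (Eventually.of_forall fun x => le_max_right _ _)
            (Metric.ball_subset_ball ?_).eventuallyLE
          linarith
      _ ≤ ∫ x in Metric.ball p ((t + M) * ρ),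
            2 * (M * ρ) ^ 3 / (a * ρ) ^ 2 * (1 - inner ℝ ν (σ x)) ∂μ := by
          refine setIntegral_mono_ae (hP.integrableOn_negPart p h _) (hI.const_mul _) ?_
          filter_upwards [hP.norm_eq_one] with x hx
          exact max_neg_inner_le hν hx (by positivity) hcone hnorm
      _ = _ := integral_const_mul _ _
  · intro x hx
    have hx' := hx.2
    rw [mem_ball_iff_norm] at hx'
    rw [measureReal_def, measureReal_def,
      ← measure_preimage_add volume x (Metric.ball (p + ρ • e) (t * ρ) \ E)]
    refine ENNReal.toReal_mono ?_ (measure_mono ?_)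
    · exact measure_ne_top_of_subset (fun h hh => hh.1)
        (measure_ball_lt_top (x := ρ • e) (r := 2 * (t * ρ)) (μ := volume)).ne
    · intro h hh
      refine ⟨?_, hh⟩
      have h1 := hh.1
      rw [mem_ball_iff_norm] at h1 ⊢
      calc ‖h - ρ • e‖ = ‖(x + h - (p + ρ • e)) - (x - p)‖ := by congr 1; abel
        _ ≤ ‖x + h - (p + ρ • e)‖ + ‖x - p‖ := norm_sub_le _ _
        _ < 2 * (t * ρ) := by linarith

/-- The blow-ups of `E` leave the half-space `{e | ⟪e, ν⟫ < 0}`. -/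
theorem IsPolarDerivative.eventually_volume_inter_le (hk : k ≠ 0) (hP : IsPolarDerivative E μ σ)
    (hE : MeasurableSet E) (hν : ‖ν‖ = 1)
    (hlim : Tendsto (fun ρ => (μ.real (Metric.ball p ρ))⁻¹ • ∫ y in Metric.ball p ρ, σ y ∂μ)
      (𝓝[>] 0) (𝓝 ν)) {e : EuclideanSpace ℝ (Fin k)} {t : ℝ} (ht : 0 < t)
    (hte : inner ℝ e ν ≤ -(4 * t)) {ε : ℝ} (hε : 0 < ε) :
    ∀ᶠ ρ in 𝓝[>] (0 : ℝ),
      volume.real (Metric.ball (p + ρ • e) (t * ρ) ∩ E) ≤ ε * ρ ^ k := by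
  have hlim' : Tendsto
      (fun ρ => (μ.real (Metric.ball p ρ))⁻¹ • ∫ y in Metric.ball p ρ, -σ y ∂μ)
      (𝓝[>] 0) (𝓝 (-ν)) := by
    simpa only [integral_neg, smul_neg] using hlim.neg
  have h := (hP.compl hE).eventually_volume_sdiff_le hk hE.compl ((norm_neg ν).trans hν) hlim' ht
    (e := e) (by rw [inner_neg_right]; linarith) hε
  simpa only [Set.sdiff_compl] using h

end BlowUp

/-! ### Comparison of normals -/

section Comparison

variable {k : ℕ} {F : Set (EuclideanSpace ℝ (Fin k))}

/-- At a set with nonempty reduced boundary the chosen pair is a genuine polar decomposition: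
otherwise all the normal quotients vanish. -/
theorem isPolarDerivative_polarDerivative {p : EuclideanSpace ℝ (Fin k)}
    (hp : p ∈ reducedBoundary F) :
    IsPolarDerivative F (polarDerivative F).1 (polarDerivative F).2 := by
  by_cases h : ∃ q : Measure (EuclideanSpace ℝ (Fin k)) ×
      (EuclideanSpace ℝ (Fin k) → EuclideanSpace ℝ (Fin k)), IsPolarDerivative F q.1 q.2
  · rw [polarDerivative, dif_pos h]
    exact h.choose_spec
  · obtain ⟨ν, hν, hlim⟩ := hp
    have h0 : normalQuotient F p = fun _ => 0 := by
      ext1 ρ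
      simp [normalQuotient, totalVariation, polarDerivative, dif_neg h]
    rw [h0] at hlim
    rw [← tendsto_nhds_unique tendsto_const_nhds hlim, norm_zero] at hν
    exact absurd hν zero_ne_one

theorem eventually_volume_sdiff_le (hk : k ≠ 0) (hF : NullMeasurableSet F)
    {p e : EuclideanSpace ℝ (Fin k)} (hp : p ∈ reducedBoundary F) {t : ℝ} (ht : 0 < t)
    (hte : 4 * t ≤ inner ℝ e (innerNormal F p)) {ε : ℝ} (hε : 0 < ε) :
    ∀ᶠ ρ in 𝓝[>] (0 : ℝ),
      volume.real (Metric.ball (p + ρ • e) (t * ρ) \ F) ≤ ε * ρ ^ k := by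
  obtain ⟨E, -, hE, hEF⟩ := hF.exists_measurable_superset_ae_eq
  obtain ⟨hν, hlim⟩ := innerNormal_spec hp
  filter_upwards [((isPolarDerivative_polarDerivative hp).congr_set hEF.symm
    ).eventually_volume_sdiff_le hk hE hν hlim ht hte hε] with ρ hρ
  rwa [← measureReal_congr ((ae_eq_refl _).diff hEF)]

theorem eventually_volume_inter_le (hk : k ≠ 0) (hF : NullMeasurableSet F)
    {p e : EuclideanSpace ℝ (Fin k)} (hp : p ∈ reducedBoundary F) {t : ℝ} (ht : 0 < t)
    (hte : inner ℝ e (innerNormal F p) ≤ -(4 * t)) {ε : ℝ} (hε : 0 < ε) :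
    ∀ᶠ ρ in 𝓝[>] (0 : ℝ),
      volume.real (Metric.ball (p + ρ • e) (t * ρ) ∩ F) ≤ ε * ρ ^ k := by
  obtain ⟨E, -, hE, hEF⟩ := hF.exists_measurable_superset_ae_eq
  obtain ⟨hν, hlim⟩ := innerNormal_spec hp
  filter_upwards [((isPolarDerivative_polarDerivative hp).congr_set hEF.symm
    ).eventually_volume_inter_le hk hE hν hlim ht hte hε] with ρ hρ
  rwa [← measureReal_congr ((ae_eq_refl _).inter hEF)]

/-- If, near two points of the reduced boundary, `F` seen from `p₂` is carried by the isometry `J`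
into `F` seen from `p₁`, then the blow-up half-spaces are nested, and hence equal. -/
theorem innerNormal_eq_of_eventually_mem (hk : k ≠ 0) (hF : NullMeasurableSet F)
    {p₁ p₂ : EuclideanSpace ℝ (Fin k)} (h₁ : p₁ ∈ reducedBoundary F) (h₂ : p₂ ∈ reducedBoundary F)
    (J : EuclideanSpace ℝ (Fin k) ≃ₗᵢ[ℝ] EuclideanSpace ℝ (Fin k))
    (hJ : ∀ᶠ z in 𝓝 (0 : EuclideanSpace ℝ (Fin k)), p₂ + z ∈ F → p₁ + J z ∈ F) :
    innerNormal F p₁ = J (innerNormal F p₂) := by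
  have hν₁ := (innerNormal_spec h₁).1
  have hν₂ := (innerNormal_spec h₂).1
  by_contra hne
  set u := J.symm (innerNormal F p₁) with hu
  have hJu : J u = innerNormal F p₁ := J.apply_symm_apply _
  have hun : ‖u‖ = 1 := by rw [hu, J.symm.norm_map, hν₁]
  have hlt : inner ℝ u (innerNormal F p₂) < 1 := by
    refine (inner_lt_one_iff_real_of_norm_eq_one hun hν₂).2 fun h => hne ?_
    rw [← hJu, h]
  -- The direction `e` points into the half-space at `p₂`, and `J e` out of the one at `p₁`.
  set e := innerNormal F p₂ - u with he
  obtain ⟨t, ht, hte⟩ : ∃ t : ℝ, 0 < t ∧ 4 * t = 1 - inner ℝ u (innerNormal F p₂) :=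
    ⟨(1 - inner ℝ u (innerNormal F p₂)) / 4, by linarith, by ring⟩
  have he₂ : 4 * t ≤ inner ℝ e (innerNormal F p₂) := by
    rw [he, inner_sub_left, real_inner_self_eq_norm_sq, hν₂]
    linarith
  have he₁ : inner ℝ (J e) (innerNormal F p₁) ≤ -(4 * t) := by
    rw [← hJu, J.inner_map_map, he, inner_sub_left, real_inner_self_eq_norm_sq, hun,
      real_inner_comm]
    linarith
  have hω : 0 < volume.real (Metric.ball (0 : EuclideanSpace ℝ (Fin k)) 1) :=
    volume_real_unitBall_pos
  set ω := volume.real (Metric.ball (0 : EuclideanSpace ℝ (Fin k)) 1) with hωdef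
  obtain ⟨η, hη, hJη⟩ := Metric.eventually_nhds_iff_ball.1 hJ
  have hsmall : ∀ᶠ ρ in 𝓝[>] (0 : ℝ), 0 < ρ ∧ ρ < η / (‖e‖ + t) :=
    Ioo_mem_nhdsGT (show 0 < η / (‖e‖ + t) by positivity)
  -- The tolerance is a third of the relative volume of the ball around `ρ e` of radius `t ρ`.
  have hε : 0 < t ^ k * ω / 3 := by positivity
  obtain ⟨ρ, hρ₂, hρ₁, hρ0, hρη⟩ := ((eventually_volume_sdiff_le hk hF h₂ ht he₂ hε).and
    ((eventually_volume_inter_le hk hF h₁ ht he₁ hε).and hsmall)).exists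
  rw [lt_div_iff₀ (by positivity)] at hρη
  have hm₂ : volume.real (Metric.ball (ρ • e) (t * ρ) ∩ {z | p₂ + z ∉ F}) ≤
      t ^ k * ω / 3 * ρ ^ k := by
    refine Eq.trans_le ?_ hρ₂
    rw [measureReal_def, measureReal_def, ← measure_preimage_add volume p₂
      (Metric.ball (p₂ + ρ • e) (t * ρ) \ F)]
    congr 2
    ext z
    refine and_congr ?_ Iff.rfl
    rw [mem_ball_iff_norm, mem_ball_iff_norm, add_sub_add_left_eq_sub]
  have hm₁ : volume.real (Metric.ball (ρ • e) (t * ρ) ∩ {z | p₁ + J z ∈ F}) ≤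
      t ^ k * ω / 3 * ρ ^ k := by
    refine Eq.trans_le ?_ hρ₁
    have hmp : MeasurePreserving (fun z => p₁ + J z) volume volume :=
      (measurePreserving_add_left volume p₁).comp J.measurePreserving
    rw [measureReal_def, measureReal_def, ← hmp.measure_preimage
      (Metric.isOpen_ball.measurableSet.nullMeasurableSet.inter hF)]
    congr 2
    ext z
    have : ‖p₁ + J z - (p₁ + ρ • J e)‖ = ‖z - ρ • e‖ := by
      rw [add_sub_add_left_eq_sub, ← map_smul, ← map_sub, J.norm_map]
    refine and_congr ?_ Iff.rfl
    rw [mem_ball_iff_norm, mem_ball_iff_norm, this]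
  have hcover : Metric.ball (ρ • e) (t * ρ) ⊆
      (Metric.ball (ρ • e) (t * ρ) ∩ {z | p₂ + z ∉ F}) ∪
        (Metric.ball (ρ • e) (t * ρ) ∩ {z | p₁ + J z ∈ F}) := by
    intro z hz
    have hzη : z ∈ Metric.ball (0 : EuclideanSpace ℝ (Fin k)) η := by
      have h1 := hz
      rw [mem_ball_iff_norm] at h1
      rw [mem_ball_zero_iff]
      calc ‖z‖ = ‖(z - ρ • e) + ρ • e‖ := by simp
        _ ≤ ‖z - ρ • e‖ + ‖ρ • e‖ := norm_add_le _ _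
        _ < η := by
          rw [norm_smul, Real.norm_eq_abs, abs_of_pos hρ0]
          linarith
    by_cases h : p₂ + z ∈ F
    · exact Or.inr ⟨hz, hJη z hzη h⟩
    · exact Or.inl ⟨hz, h⟩
  have hle := (measureReal_mono hcover (measure_ne_top_of_subset
    (Set.union_subset Set.inter_subset_left Set.inter_subset_left)
    (measure_ball_lt_top (μ := volume)).ne)).trans (measureReal_union_le _ _)
  rw [volume_real_ball _ (by positivity), mul_pow] at hle
  have : 0 < t ^ k * ρ ^ k * ω := by positivity
  linarith

end Comparison

/-! ### Steiner symmetric sets -/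

section Symmetral

variable {n : ℕ}

/-- The reflection `(x', y) ↦ (x', -y)`. -/
noncomputable def verticalReflection (n : ℕ) :
    EuclideanSpace ℝ (Fin (n + 1)) ≃ₗᵢ[ℝ] EuclideanSpace ℝ (Fin (n + 1)) :=
  LinearIsometryEquiv.piLpCongrRight 2 fun i =>
    if i = Fin.last n then LinearIsometryEquiv.neg ℝ else LinearIsometryEquiv.refl ℝ ℝ

theorem verticalReflection_castSucc (z : EuclideanSpace ℝ (Fin (n + 1))) (i : Fin n) :
    verticalReflection n z i.castSucc = z i.castSucc := by
  simp [verticalReflection, (Fin.castSucc_lt_last i).ne]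

theorem verticalReflection_last (z : EuclideanSpace ℝ (Fin (n + 1))) :
    verticalReflection n z (Fin.last n) = -z (Fin.last n) := by
  simp [verticalReflection]

theorem point_add_mem_symmetral_iff (v : EuclideanSpace ℝ (Fin n) → ℝ)
    (x' : EuclideanSpace ℝ (Fin n)) (y : ℝ) (z : EuclideanSpace ℝ (Fin (n + 1))) :
    point x' y + z ∈ symmetral v ↔ |y + z (Fin.last n)| < 1 / 2 * v (x' + base z) := by
  have h1 : base (point x' y + z) = x' + base z := by
    ext i
    simp [base, point]
  have h2 : height (point x' y + z) = y + z (Fin.last n) := by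
    simp [height, point]
  change |height _| < 1 / 2 * v (base _) ↔ _
  rw [h1, h2]

theorem innerNormal_symmetral_eq {v : EuclideanSpace ℝ (Fin n) → ℝ}
    (hF : NullMeasurableSet (symmetral v)) {x' : EuclideanSpace ℝ (Fin n)} {y₁ y₂ : ℝ}
    (h₁ : y₁ ∈ slice (reducedBoundary (symmetral v)) x')
    (h₂ : y₂ ∈ slice (reducedBoundary (symmetral v)) x') :
    (∀ i : Fin n, innerNormal (symmetral v) (point x' y₁) i.castSucc =
      innerNormal (symmetral v) (point x' y₂) i.castSucc) ∧
    |innerNormal (symmetral v) (point x' y₁) (Fin.last n)| =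
      |innerNormal (symmetral v) (point x' y₂) (Fin.last n)| := by
  wlog hle : |y₁| ≤ |y₂| generalizing y₁ y₂
  · obtain ⟨h3, h4⟩ := this h₂ h₁ (not_le.1 hle).le
    exact ⟨fun i => (h3 i).symm, h4.symm⟩
  rcases hle.lt_or_eq with hlt | heq
  -- The vertical slices of `symmetral v` are intervals centered at `0`.
  · have hJ : ∀ᶠ z in 𝓝 (0 : EuclideanSpace ℝ (Fin (n + 1))),
        point x' y₂ + z ∈ symmetral v →
          point x' y₁ + LinearIsometryEquiv.refl ℝ _ z ∈ symmetral v := by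
      have hc₁ : Continuous fun z : EuclideanSpace ℝ (Fin (n + 1)) => |y₁ + z (Fin.last n)| := by
        fun_prop
      have hc₂ : Continuous fun z : EuclideanSpace ℝ (Fin (n + 1)) => |y₂ + z (Fin.last n)| := by
        fun_prop
      filter_upwards [hc₁.continuousAt.eventually_lt hc₂.continuousAt (by simpa using hlt)]
        with z hz hmem
      change point x' y₁ + z ∈ symmetral v
      rw [point_add_mem_symmetral_iff]
      rw [point_add_mem_symmetral_iff] at hmem
      exact hz.trans hmem
    have h : innerNormal (symmetral v) (point x' y₁) = innerNormal (symmetral v) (point x' y₂) :=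
      innerNormal_eq_of_eventually_mem n.succ_ne_zero hF h₁ h₂ _ hJ
    simp [h]
  · rcases abs_eq_abs.1 heq with rfl | rfl
    · simp
    · have hJ : ∀ᶠ z in 𝓝 (0 : EuclideanSpace ℝ (Fin (n + 1))),
          point x' y₂ + z ∈ symmetral v →
            point x' (-y₂) + verticalReflection n z ∈ symmetral v := by
        refine Eventually.of_forall fun z hz => ?_
        have hb : base (verticalReflection n z) = base z := by
          ext i
          exact verticalReflection_castSucc z i
        rw [point_add_mem_symmetral_iff] at hz ⊢
        rwa [hb, verticalReflection_last, ← neg_add, abs_neg]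
      have h := innerNormal_eq_of_eventually_mem n.succ_ne_zero hF h₁ h₂ _ hJ
      rw [h]
      exact ⟨fun i => verticalReflection_castSucc _ i, by rw [verticalReflection_last, abs_neg]⟩

end Symmetral

end Steiner

theorem mainTheorem4 (n : ℕ) (hn : 1 ≤ n) (v : EuclideanSpace ℝ (Fin n) → ℝ)
    (hv : NullMeasurable v volume) (hv_nonneg : ∀ x', 0 ≤ v x')
    (hF : Steiner.IsLocallyFinitePerimeter (Steiner.symmetral v))
    (x' : EuclideanSpace ℝ (Fin n))
    (hx' : (Steiner.slice (Steiner.reducedBoundary (Steiner.symmetral v)) x').Nonempty) :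
    (∀ i : Fin n, ∃ c : ℝ, ∀ y ∈ Steiner.slice (Steiner.reducedBoundary (Steiner.symmetral v)) x',
      Steiner.innerNormal (Steiner.symmetral v) (Steiner.point x' y) i.castSucc = c) ∧
    (∃ c : ℝ, ∀ y ∈ Steiner.slice (Steiner.reducedBoundary (Steiner.symmetral v)) x',
      |Steiner.innerNormal (Steiner.symmetral v) (Steiner.point x' y) (Fin.last n)| = c) := by
  obtain ⟨y₀, hy₀⟩ := hx'
  exact ⟨fun i => ⟨_, fun y hy => (Steiner.innerNormal_symmetral_eq hF.1 hy hy₀).1 i⟩,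
    ⟨_, fun y hy => (Steiner.innerNormal_symmetral_eq hF.1 hy hy₀).2⟩⟩
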